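/- **Proposition (floating-point error in the HyKKT right-hand side).** Consider $\min_{x,s} f(x)$ subject to $g(x)=0$, $h(x)+s=0$, $s\ge 0$, with $x\in\mathbb R^n$ and twice continuously differentiable $f:\mathbb R^n\to\mathbb R$, $g:\mathbb R^n\to\mathbb R^{m_e}$, $h:\mathbb R^n\to\mathbb R^{m_i}$, and its Lagrangian $\mathcal L=f(x)+y^\top g(x)+z^\top(h(x)+s)-v^\top s$. Write $p=(x,s,y,z)$, and let $(p^\star,v^\star)$ be a KKT point at which $\nabla^2_{xx}\mathcal L$ is locally Lipschitz and the linear independence constraint qualification, strict complementarity and the second-order sufficient condition hold. Let $m_a$ be the number of constraints $h_i$ active at $x^\star$, and $\ell=m_e+m_a$. All norms are 2-norms. At an iterate $(p,v)$ with $(s,v)>0$ put $\Xi=s^\top v/m_i$, $W=\nabla^2_{xx}\mathcal L$, $G=\nabla g(x)$, $H=\nabla h(x)$, $D_s=\mathrm{diag}(v_i/s_i)$, and, for a barrier parameter $\mu$ and $\gamma>0$, $$r_1=\nabla f(x)+G^\top y+H^\top z,\quad r_2=z-\mu S^{-1}e,\quad r_3=g(x),\quad r_4=h(x)+s,$$ $$\bar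 r_1=-\bigl(r_1+H^\top(D_s r_4-r_2)\bigr),\quad \bar r_2=-r_3,\quad s_\gamma=\bar r_1+\gamma G^\top\bar r_2,$$ $$K_\gamma=W+H^\top D_sH+\gamma G^\top G,\qquad r_\gamma=GK_\gamma^{-1}s_\gamma-\bar r_2 .$$ *Floating-point model* with unit roundoff $\mathbf u$ and constants $c,\varepsilon\ge 0$; computed quantities carry a hat. The quantities $\nabla f,g,h,G,H,W$ are computed with absolute error at most $c\,\mathbf u$. The sum of products $r_1$ is evaluated from the computed $\nabla f$, $G$, $H$ with a relative perturbation of at most $c\,\mathbf u$ in each term. The divisions $v_i/s_i$ and $\mu/s_i$, the subtractions in $r_2$, the additions in $r_4$, and the diagonal entries $\gamma$ used to assemble $\gamma G^\top G$ are rounded with relative error at most $\mathbf u$. The computed $\widehat{\bar r}_1,\widehat{\bar r}_2$ and $\widehat s_\gamma=\widehat{\bar r}_1+\gamma\widehat G^\top\widehat{\bar r}_2$ are the formulas above evaluated on these data. Moreover $$\widehat K_\gamma=\widehat W+\widehat H^\top\widehat D_s\widehat H+\widehat G^\top\widehat D_\gamma^{e}\,\widehat G+\Delta_sK_\gamma,$$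 where $\widehat D_\gamma^{e}$ is the rounded $\gamma I$ and $\Delta_sK_\gamma$ is a symmetric backward error of the Cholesky solve with $\|\Delta_sK_\gamma\|\le\mathbf u\,\varepsilon\,\|K_\gamma\|$. Finally $\widehat r_\gamma=\widehat G\widehat K_\gamma^{-1}\widehat s_\gamma-\widehat{\bar r}_2$. Put $\Delta s_\gamma=\widehat s_\gamma-s_\gamma$ and $\Delta\bar r_2=\widehat{\bar r}_2-\bar r_2$. *Claim.* Let $C>0$, $\alpha\in(0,1)$, $0<a\le b$, $M>0$, $c,\varepsilon\ge0$. There are $\rho,\eta,B>0$, depending only on the problem, on $(p^\star,v^\star)$ and on these constants, such that the following holds for every iterate $(p,v)$ at distance at most $\rho$ from $(p^\star,v^\star)$ that satisfies the centrality conditions $$\|\nabla_p\mathcal L(p,v)\|\le C\,\Xi,\qquad (s,v)>0,\qquad s_iv_i\ge\alpha\,\Xi\ \text{ for all } i,$$ all $\gamma\in[a/\Xi,\,b/\Xi]$, all $\mu\in(0,M\Xi]$, all $\mathbf u\in(0,\eta\,\Xi]$, and every floating-point evaluation as above. 1. $K_\gamma$ and $\widehat K_\gamma$ are invertible, and $\|\widehat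 r_\gamma-r_\gamma\|\le B\,\mathbf u$. 2. The error propagated from the vectors $s_\gamma,\bar r_2$ through the computed operator, $$\Delta\widehat r_\gamma:=\widehat r_\gamma-\bigl(\widehat G\widehat K_\gamma^{-1}s_\gamma-\bar r_2\bigr)=-\Delta\bar r_2+\widehat G\widehat K_\gamma^{-1}\Delta s_\gamma,$$ satisfies $\|\Delta\widehat r_\gamma\|\le B\,\mathbf u$; also $\|K_\gamma^{-1}\Delta s_\gamma\|\le B\,\mathbf u$. 3. The large-space part is damped by $\Sigma_L^{-1}$. Let $K_\gamma=U\Sigma U^\top$ be any orthogonal diagonalization with eigenvalues in order of decreasing magnitude. Let $U_L,\Sigma_L$ correspond to the first $\ell$ eigenvalues and $U_S,\Sigma_S$ to the others. Then $\Sigma_L$ and $\Sigma_S$ are invertible, $$K_\gamma^{-1}\Delta s_\gamma=U_L\Sigma_L^{-1}U_L^\top\Delta s_\gamma+U_S\Sigma_S^{-1}U_S^\top\Delta s_\gamma,$$ $$\|U_L^\top\Delta s_\gamma\|\le B\,\mathbf u/\Xi,\quad \|\Sigma_L^{-1}\|\le B\,\Xi,\quad \|\Sigma_L^{-1}U_L^\top\Delta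 s_\gamma\|\le B\,\mathbf u,\quad \|U_S^\top\Delta s_\gamma\|\le B\,\mathbf u,\quad \|\Sigma_S^{-1}\|\le B .$$ -/

import Mathlib

open scoped Matrix Matrix.Norms.L2Operator

noncomputable section

namespace HyKKT

/-- Euclidean space `ℝⁿ` with the 2-norm. Matrices carry the spectral norm (`L2Operator`). -/
abbrev Vec (n : ℕ) := EuclideanSpace ℝ (Fin n)

/-- Euclidean norm of a coordinate vector. -/
def norm2 {ι : Type} [Fintype ι] (v : ι → ℝ) : ℝ := ‖WithLp.toLp 2 v‖

/-- The `j`-th vector of the canonical basis of `ℝⁿ`. -/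
def basisVec {n : ℕ} (j : Fin n) : Vec n := EuclideanSpace.single j (1 : ℝ)

/-- Jacobian matrix of `F` at `x`. -/
def jacobian {n m : ℕ} (F : Vec n → Vec m) (x : Vec n) : Matrix (Fin m) (Fin n) ℝ :=
  Matrix.of fun k j => (fderiv ℝ F x (basisVec j)) k

/-- Hessian matrix of `φ` at `x`. -/
def hessianMatrix {n : ℕ} (φ : Vec n → ℝ) (x : Vec n) : Matrix (Fin n) (Fin n) ℝ :=
  Matrix.of fun i j => fderiv ℝ (fun x' => fderiv ℝ φ x' (basisVec j)) x (basisVec i)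

/-- The data of `min f(x)` subject to `g(x) = 0`, `h(x) + s = 0`, `s ≥ 0`. -/
structure NLP (n me mi : ℕ) where
  f : Vec n → ℝ
  g : Vec n → Vec me
  h : Vec n → Vec mi

/-! Splitting of `U Σ Uᵀ`, with `Σ = diag σ`, into the large space (first `l` columns of `U`) and the
small space (remaining columns). -/

abbrev LargeIdx (n l : ℕ) := {i : Fin n // i.val < l}

abbrev SmallIdx (n l : ℕ) := {i : Fin n // ¬ i.val < l}

/-- `U_L` -/
def colsL {n : ℕ} (l : ℕ) (U : Matrix (Fin n) (Fin n) ℝ) : Matrix (Fin n) (LargeIdx n l) ℝ :=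
  U.submatrix id Subtype.val

/-- `U_S` -/
def colsS {n : ℕ} (l : ℕ) (U : Matrix (Fin n) (Fin n) ℝ) : Matrix (Fin n) (SmallIdx n l) ℝ :=
  U.submatrix id Subtype.val

/-- `Σ_L` -/
def diagL {n : ℕ} (l : ℕ) (σ : Fin n → ℝ) : Matrix (LargeIdx n l) (LargeIdx n l) ℝ :=
  Matrix.diagonal fun i => σ i.val

/-- `Σ_S` -/
def diagS {n : ℕ} (l : ℕ) (σ : Fin n → ℝ) : Matrix (SmallIdx n l) (SmallIdx n l) ℝ :=
  Matrix.diagonal fun i => σ i.val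

/-- A primal-dual point `(p, v)` with `p = (x, s, y, z)`; `v` is the multiplier of `s ≥ 0`. -/
structure Point (n me mi : ℕ) where
  x : Vec n
  s : Vec mi
  y : Vec me
  z : Vec mi
  v : Vec mi

namespace Point

variable {n me mi : ℕ}

/-- Euclidean distance between two primal-dual points. -/
def distance (w w' : Point n me mi) : ℝ :=
  Real.sqrt (‖w.x - w'.x‖ ^ 2 + ‖w.s - w'.s‖ ^ 2 + ‖w.y - w'.y‖ ^ 2
    + ‖w.z - w'.z‖ ^ 2 + ‖w.v - w'.v‖ ^ 2)

/-- Duality measure `Ξ(s, v) = sᵀ v / m_i`. -/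
def dualityMeasure (w : Point n me mi) : ℝ := (∑ i, w.s i * w.v i) / (mi : ℝ)

/-- Diagonal of `D_s = S⁻¹ V`. -/
def Ds (w : Point n me mi) : Fin mi → ℝ := fun i => w.v i / w.s i

end Point

namespace NLP

variable {n me mi : ℕ}

/-- `f`, `g`, `h` are twice continuously differentiable. -/
def IsC2 (P : NLP n me mi) : Prop :=
  ContDiff ℝ 2 P.f ∧ ContDiff ℝ 2 P.g ∧ ContDiff ℝ 2 P.h

/-- Lagrangian `f(x) + yᵀ g(x) + zᵀ (h(x) + s) - vᵀ s`. -/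
def lagrangian (P : NLP n me mi) (x : Vec n) (s : Vec mi) (y : Vec me) (z v : Vec mi) : ℝ :=
  P.f x + inner ℝ y (P.g x) + inner ℝ z (P.h x + s) - inner ℝ v s

def gradX (P : NLP n me mi) (w : Point n me mi) : Vec n :=
  gradient (fun x => P.lagrangian x w.s w.y w.z w.v) w.x

def gradS (P : NLP n me mi) (w : Point n me mi) : Vec mi :=
  gradient (fun s => P.lagrangian w.x s w.y w.z w.v) w.s

def gradY (P : NLP n me mi) (w : Point n me mi) : Vec me :=
  gradient (fun y => P.lagrangian w.x w.s y w.z w.v) w.y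

def gradZ (P : NLP n me mi) (w : Point n me mi) : Vec mi :=
  gradient (fun z => P.lagrangian w.x w.s w.y z w.v) w.z

/-- Norm of the gradient of the Lagrangian with respect to `p = (x, s, y, z)`. -/
def gradPNorm (P : NLP n me mi) (w : Point n me mi) : ℝ :=
  Real.sqrt (‖P.gradX w‖ ^ 2 + ‖P.gradS w‖ ^ 2 + ‖P.gradY w‖ ^ 2 + ‖P.gradZ w‖ ^ 2)

/-- `W`, the Hessian of the Lagrangian in `x`. -/
def W (P : NLP n me mi) (w : Point n me mi) : Matrix (Fin n) (Fin n) ℝ :=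
  hessianMatrix (fun x => P.lagrangian x w.s w.y w.z w.v) w.x

/-- `G`, the Jacobian of the equality constraints. -/
def G (P : NLP n me mi) (w : Point n me mi) : Matrix (Fin me) (Fin n) ℝ := jacobian P.g w.x

/-- `H`, the Jacobian of the inequality constraints. -/
def H (P : NLP n me mi) (w : Point n me mi) : Matrix (Fin mi) (Fin n) ℝ := jacobian P.h w.x

/-- Active set at `x`. -/
def activeSet (P : NLP n me mi) (x : Vec n) : Set (Fin mi) := {i | P.h x i = 0}

/-- `ℓ = m_e + m_a`, with `m_a` the number of active inequality constraints at `x`. -/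
def largeDim (P : NLP n me mi) (x : Vec n) : ℕ := me + (P.activeSet x).ncard

/-- Active Jacobian: all rows of `∇g` and the rows of `∇h` that belong to active constraints. -/
def activeJacobian (P : NLP n me mi) (w : Point n me mi) :
    Matrix (Fin me ⊕ P.activeSet w.x) (Fin n) ℝ :=
  Matrix.fromRows (P.G w) ((P.H w).submatrix Subtype.val id)

/-- KKT conditions. -/
structure IsKKT (P : NLP n me mi) (w : Point n me mi) : Prop where
  stationary : gradient P.f w.x + WithLp.toLp 2 ((P.G w)ᵀ *ᵥ w.y.ofLp)
    + WithLp.toLp 2 ((P.H w)ᵀ *ᵥ w.z.ofLp) = 0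
  multiplier : w.z - w.v = 0
  equality : P.g w.x = 0
  inequality : P.h w.x + w.s = 0
  slack_nonneg : ∀ i, 0 ≤ w.s i
  mult_nonneg : ∀ i, 0 ≤ w.v i
  complementarity : ∀ i, w.s i * w.v i = 0

/-- `w` is a KKT point at which the Hessian of the Lagrangian is locally Lipschitz and LICQ, strict
complementarity and the second-order sufficient condition hold. -/
structure IsRegularSolution (P : NLP n me mi) (w : Point n me mi) : Prop where
  kkt : P.IsKKT w
  lipschitz : ∃ r > 0, ∃ Λ : ℝ, ∀ w₁ w₂ : Point n me mi,
    w₁.distance w ≤ r → w₂.distance w ≤ r → ‖P.W w₁ - P.W w₂‖ ≤ Λ * w₁.distance w₂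
  licq : LinearIndependent ℝ (P.activeJacobian w).row
  scs : ∀ i ∈ P.activeSet w.x, 0 < w.z i
  sosc : ∀ d : Fin n → ℝ, d ≠ 0 → P.activeJacobian w *ᵥ d = 0 → 0 < d ⬝ᵥ (P.W w *ᵥ d)

/-- Centrality conditions with constants `C` and `α`. -/
structure IsCentral (P : NLP n me mi) (C α : ℝ) (w : Point n me mi) : Prop where
  residual : P.gradPNorm w ≤ C * w.dualityMeasure
  slack_pos : ∀ i, 0 < w.s i
  mult_pos : ∀ i, 0 < w.v i
  products : ∀ i, α * w.dualityMeasure ≤ w.s i * w.v i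

/-! Exact right-hand sides and matrices. -/

def r1 (P : NLP n me mi) (w : Point n me mi) : Fin n → ℝ :=
  (gradient P.f w.x).ofLp + (P.G w)ᵀ *ᵥ w.y.ofLp + (P.H w)ᵀ *ᵥ w.z.ofLp

def r2 (_P : NLP n me mi) (μ : ℝ) (w : Point n me mi) : Fin mi → ℝ := fun i => w.z i - μ / w.s i

def r3 (P : NLP n me mi) (w : Point n me mi) : Fin me → ℝ := fun j => P.g w.x j

def r4 (P : NLP n me mi) (w : Point n me mi) : Fin mi → ℝ := fun i => P.h w.x i + w.s i

/-- `r̄₁ = -(r₁ + Hᵀ (D_s r₄ - r₂))`. -/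
def rbar1 (P : NLP n me mi) (μ : ℝ) (w : Point n me mi) : Fin n → ℝ :=
  -(P.r1 w + (P.H w)ᵀ *ᵥ (w.Ds * P.r4 w - P.r2 μ w))

/-- `r̄₂ = -r₃`. -/
def rbar2 (P : NLP n me mi) (w : Point n me mi) : Fin me → ℝ := -P.r3 w

/-- `s_γ = r̄₁ + γ Gᵀ r̄₂`. -/
def sGamma (P : NLP n me mi) (γ μ : ℝ) (w : Point n me mi) : Fin n → ℝ :=
  P.rbar1 μ w + γ • ((P.G w)ᵀ *ᵥ P.rbar2 w)

/-- `K_γ = W + Hᵀ D_s H + γ Gᵀ G`. -/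
def KGamma (P : NLP n me mi) (γ : ℝ) (w : Point n me mi) : Matrix (Fin n) (Fin n) ℝ :=
  P.W w + (P.H w)ᵀ * Matrix.diagonal w.Ds * P.H w + γ • ((P.G w)ᵀ * P.G w)

/-- `r_γ = G K_γ⁻¹ s_γ - r̄₂`. -/
def rGamma (P : NLP n me mi) (γ μ : ℝ) (w : Point n me mi) : Fin me → ℝ :=
  P.G w *ᵥ ((P.KGamma γ w)⁻¹ *ᵥ P.sGamma γ μ w) - P.rbar2 w

end NLP

/-- `b` is the real number `a` rounded with unit roundoff `u`. -/
def IsRounding (u a b : ℝ) : Prop := ∃ τ : ℝ, |τ| ≤ u ∧ b = a * (1 + τ)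

/-- The quantities computed in floating-point arithmetic at a primal-dual point. -/
structure FloatEval (n me mi : ℕ) where
  /-- computed `∇f(x)` -/
  gradf : Vec n
  /-- computed `g(x)`, that is, the computed `r₃` -/
  g : Vec me
  /-- computed `h(x)` -/
  h : Vec mi
  G : Matrix (Fin me) (Fin n) ℝ
  H : Matrix (Fin mi) (Fin n) ℝ
  W : Matrix (Fin n) (Fin n) ℝ
  r1 : Fin n → ℝ
  r2 : Fin mi → ℝ
  r4 : Fin mi → ℝ
  /-- computed diagonal of `D_s` -/
  Ds : Fin mi → ℝ
  /-- computed diagonal of `γ I` -/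
  Dγ : Fin me → ℝ
  /-- backward error of the Cholesky solve with the assembled matrix -/
  cholErr : Matrix (Fin n) (Fin n) ℝ

namespace FloatEval

variable {n me mi : ℕ}

/-- The floating-point model with unit roundoff `u`. The problem functions and their derivatives are
evaluated with an absolute error of at most `c u`. Each division, addition and subtraction, and the
storage of `γ`, is rounded with relative error at most `u`. The sum of products that defines
`r₁ = ∇f + Gᵀ y + Hᵀ z` perturbs each of its terms by a relative error of at most `c u` (the standard
model of an inner product, for any order of summation). The linear solve is backward stable with
constant `ε`. -/
structure IsValid (F : FloatEval n me mi) (P : NLP n me mi) (w : Point n me mi)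
    (γ μ u c ε : ℝ) : Prop where
  gradf_err : ‖F.gradf - gradient P.f w.x‖ ≤ c * u
  g_err : ‖F.g - P.g w.x‖ ≤ c * u
  h_err : ‖F.h - P.h w.x‖ ≤ c * u
  G_err : ‖F.G - P.G w‖ ≤ c * u
  H_err : ‖F.H - P.H w‖ ≤ c * u
  W_err : ‖F.W - P.W w‖ ≤ c * u
  r1_round : ∀ j, ∃ (θ₀ : ℝ) (θG : Fin me → ℝ) (θH : Fin mi → ℝ),
    |θ₀| ≤ c * u ∧ (∀ k, |θG k| ≤ c * u) ∧ (∀ k, |θH k| ≤ c * u) ∧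
    F.r1 j = F.gradf j * (1 + θ₀) + ∑ k, F.G k j * w.y k * (1 + θG k)
      + ∑ k, F.H k j * w.z k * (1 + θH k)
  r2_round : ∀ i, ∃ q, IsRounding u (μ / w.s i) q ∧ IsRounding u (w.z i - q) (F.r2 i)
  r4_round : ∀ i, IsRounding u (F.h i + w.s i) (F.r4 i)
  Ds_round : ∀ i, IsRounding u (w.v i / w.s i) (F.Ds i)
  Dγ_round : ∀ j, IsRounding u γ (F.Dγ j)
  chol_symm : F.cholErr.IsSymm
  chol_stable : ‖F.cholErr‖ ≤ u * ε * ‖P.KGamma γ w‖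

/-- Computed `r̄₁`. -/
def rbar1 (F : FloatEval n me mi) : Fin n → ℝ := -(F.r1 + F.Hᵀ *ᵥ (F.Ds * F.r4 - F.r2))

/-- Computed `r̄₂`. -/
def rbar2 (F : FloatEval n me mi) : Fin me → ℝ := -F.g.ofLp

/-- `ŝ_γ`. -/
def sGamma (F : FloatEval n me mi) (γ : ℝ) : Fin n → ℝ := F.rbar1 + γ • (F.Gᵀ *ᵥ F.rbar2)

/-- `Δs_γ = ŝ_γ - s_γ`. -/
def deltaS (F : FloatEval n me mi) (P : NLP n me mi) (γ μ : ℝ) (w : Point n me mi) : Fin n → ℝ :=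
  F.sGamma γ - P.sGamma γ μ w

/-- `Δr̄₂`, computed minus exact. -/
def deltaRbar2 (F : FloatEval n me mi) (P : NLP n me mi) (w : Point n me mi) : Fin me → ℝ :=
  F.rbar2 - P.rbar2 w

/-- `K̂_γ`: the matrix assembled from the computed data, plus the backward error of the solver. -/
def KGamma (F : FloatEval n me mi) : Matrix (Fin n) (Fin n) ℝ :=
  F.W + F.Hᵀ * Matrix.diagonal F.Ds * F.H + F.Gᵀ * Matrix.diagonal F.Dγ * F.G + F.cholErr

/-- `r̂_γ = Ĝ K̂_γ⁻¹ ŝ_γ - r̄₂`. -/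
def rGamma (F : FloatEval n me mi) (γ : ℝ) : Fin me → ℝ :=
  F.G *ᵥ (F.KGamma⁻¹ *ᵥ F.sGamma γ) - F.rbar2

end FloatEval

end HyKKT

end

open scoped Matrix Matrix.Norms.L2Operator

namespace HyKKT

open Asymptotics Filter Topology

section MatrixAsymptotics

variable {X : Type*} {l : Filter X} {m n k : Type} [Fintype m] [Fintype n] [Fintype k]

theorem isBigO_linearMap {E F : Type*} [NormedAddCommGroup E] [NormedSpace ℝ E]
    [FiniteDimensional ℝ E] [NormedAddCommGroup F] [NormedSpace ℝ F] (T : E →ₗ[ℝ] F) {A : X → E}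
    {f : X → ℝ} (hA : A =O[l] f) : (fun x => T (A x)) =O[l] f :=
  ((LinearMap.toContinuousLinearMap T).isBigO_comp A l).trans hA

theorem isBigO_apply [DecidableEq n] {A : X → Matrix m n ℝ} {f : X → ℝ} (hA : A =O[l] f)
    (i : m) (j : n) : (fun x => A x i j) =O[l] f :=
  isBigO_linearMap (Matrix.entryLinearMap ℝ ℝ i j) hA

theorem isBigO_matrix [DecidableEq n] {A : X → Matrix m n ℝ} {f : X → ℝ}
    (hA : ∀ i j, (fun x => A x i j) =O[l] f) : A =O[l] f := by
  have h : (fun x => (fun i j => A x i j : m → n → ℝ)) =O[l] f :=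
    isBigO_pi.2 fun i => isBigO_pi.2 fun j => hA i j
  exact isBigO_linearMap (Matrix.ofLinearEquiv ℝ).toLinearMap h

theorem isBigO_matrix_mul [DecidableEq n] [DecidableEq k] {A : X → Matrix m n ℝ}
    {B : X → Matrix n k ℝ} {f g : X → ℝ} (hA : A =O[l] f) (hB : B =O[l] g) :
    (fun x => A x * B x) =O[l] fun x => f x * g x :=
  (IsBigO.of_norm_le fun x => Matrix.l2_opNorm_mul (A x) (B x)).trans
    (hA.norm_left.mul hB.norm_left)

theorem isBigO_transpose [DecidableEq m] [DecidableEq n] {A : X → Matrix m n ℝ} {f : X → ℝ}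
    (hA : A =O[l] f) : (fun x => (A x)ᵀ) =O[l] f :=
  isBigO_matrix fun i j => isBigO_apply hA j i

theorem isBigO_diagonal [DecidableEq n] {v : X → n → ℝ} {f : X → ℝ} (hv : v =O[l] f) :
    (fun x => Matrix.diagonal (v x)) =O[l] f :=
  (IsBigO.of_norm_le fun x => (Matrix.l2_opNorm_diagonal (v x)).le).trans hv.norm_left

theorem isBigO_mulVec [DecidableEq n] {A : X → Matrix m n ℝ} {v : X → n → ℝ} {f g : X → ℝ}
    (hA : A =O[l] f) (hv : v =O[l] g) : (fun x => A x *ᵥ v x) =O[l] fun x => f x * g x :=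
  isBigO_pi.2 fun i => IsBigO.fun_sum fun j _ => (isBigO_apply hA i j).mul (isBigO_pi.1 hv j)

theorem isBigO_norm2 {v : X → n → ℝ} {f : X → ℝ} (hv : v =O[l] f) :
    (fun x => norm2 (v x)) =O[l] f :=
  (isBigO_linearMap (WithLp.linearEquiv 2 ℝ (n → ℝ)).symm.toLinearMap hv).norm_left

/-- If `J` has a limit with linearly independent rows, then `Jᵀ Y = O(f)` implies `Y = O(f)`. -/
theorem exists_leftInverse_transpose [DecidableEq m] [DecidableEq n] {J : X → Matrix m n ℝ}
    {J₀ : Matrix m n ℝ} (hJ : Tendsto J l (𝓝 J₀)) (hli : LinearIndependent ℝ J₀.row) :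
    ∃ L : X → Matrix m n ℝ, L =O[l] (fun _ => (1 : ℝ)) ∧ ∀ᶠ x in l, L x * (J x)ᵀ = 1 := by
  have hdet : IsUnit (J₀ * J₀ᵀ).det := by
    rw [← Matrix.isUnit_iff_isUnit_det, ← Matrix.mulVec_injective_iff_isUnit]
    refine (injective_iff_map_eq_zero (J₀ * J₀ᵀ).mulVecLin).2 fun v hv => ?_
    have h0 : v ᵥ* J₀ = 0 := by
      rw [Matrix.mulVecLin_apply, ← Matrix.mulVec_mulVec, Matrix.mulVec_transpose] at hv
      rw [← dotProduct_self_eq_zero, ← Matrix.dotProduct_mulVec, hv, dotProduct_zero]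
    exact Matrix.vecMul_injective_iff.2 hli (h0.trans (Matrix.zero_vecMul J₀).symm)
  have hJJ : Tendsto (fun x => J x * (J x)ᵀ) l (𝓝 (J₀ * J₀ᵀ)) :=
    ((continuous_id.matrix_mul continuous_id.matrix_transpose).tendsto J₀).comp hJ
  have hd : Tendsto (fun x => (J x * (J x)ᵀ).det) l (𝓝 (J₀ * J₀ᵀ).det) :=
    (continuous_id.matrix_det.tendsto _).comp hJJ
  have hne : ∀ᶠ x in l, (J x * (J x)ᵀ).det ≠ 0 := hd.eventually_ne hdet.ne_zero
  have hinv : Tendsto (fun x => (J x * (J x)ᵀ)⁻¹) l (𝓝 (J₀ * J₀ᵀ)⁻¹) := by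
    simp only [Matrix.inv_def, Ring.inverse_eq_inv']
    exact (hd.inv₀ hdet.ne_zero).smul ((continuous_id.matrix_adjugate.tendsto _).comp hJJ)
  refine ⟨fun x => (J x * (J x)ᵀ)⁻¹ * J x, ?_, ?_⟩
  · simpa using isBigO_matrix_mul (hinv.isBigO_one ℝ) (hJ.isBigO_one ℝ)
  · filter_upwards [hne] with x hx
    rw [Matrix.mul_assoc, Matrix.nonsing_inv_mul _ (isUnit_iff_ne_zero.2 hx)]

theorem isBigO_of_transpose_mul [DecidableEq m] [DecidableEq n] [DecidableEq k]
    {J : X → Matrix m n ℝ} {J₀ : Matrix m n ℝ} (hJ : Tendsto J l (𝓝 J₀))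
    (hli : LinearIndependent ℝ J₀.row) {Y : X → Matrix m k ℝ} {f : X → ℝ}
    (hY : (fun x => (J x)ᵀ * Y x) =O[l] f) : Y =O[l] f := by
  obtain ⟨L, hL, hLJ⟩ := exists_leftInverse_transpose hJ hli
  have := isBigO_matrix_mul hL hY
  simp only [one_mul] at this
  refine this.congr' ?_ EventuallyEq.rfl
  filter_upwards [hLJ] with x hx
  rw [← Matrix.mul_assoc, hx, Matrix.one_mul]

end MatrixAsymptotics

section Vectors

variable {m n : Type} [Fintype m] [Fintype n]

theorem norm2_sq (v : n → ℝ) : norm2 v ^ 2 = v ⬝ᵥ v := by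
  simp [norm2, EuclideanSpace.real_norm_sq_eq, dotProduct, ← sq]

theorem norm2_nonneg (v : n → ℝ) : 0 ≤ norm2 v := norm_nonneg _

theorem norm2_pos {v : n → ℝ} (hv : v ≠ 0) : 0 < norm2 v := by
  simpa [norm2] using hv

theorem norm2_mulVec_le [DecidableEq n] (A : Matrix m n ℝ) (v : n → ℝ) :
    norm2 (A *ᵥ v) ≤ ‖A‖ * norm2 v :=
  Matrix.l2_opNorm_mulVec A (WithLp.toLp 2 v)

theorem abs_dotProduct_le (v w : n → ℝ) : |v ⬝ᵥ w| ≤ norm2 v * norm2 w := by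
  have := abs_real_inner_le_norm (WithLp.toLp 2 v : EuclideanSpace ℝ n) (WithLp.toLp 2 w)
  rwa [EuclideanSpace.inner_toLp_toLp, dotProduct_comm] at this

end Vectors

section Coercive

variable {X : Type*} {l : Filter X} {m n : Type} [Fintype m] [Fintype n]

theorem dotProduct_mulVec_smul (Q : Matrix n n ℝ) (t : ℝ) (d : n → ℝ) :
    (t • d) ⬝ᵥ (Q *ᵥ (t • d)) = t ^ 2 * (d ⬝ᵥ (Q *ᵥ d)) := by
  simp [Matrix.mulVec_smul]; ring

theorem dotProduct_transpose_mul_mulVec (J : Matrix m n ℝ) (d : n → ℝ) :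
    d ⬝ᵥ ((Jᵀ * J) *ᵥ d) = norm2 (J *ᵥ d) ^ 2 := by
  rw [norm2_sq, ← Matrix.mulVec_mulVec, Matrix.dotProduct_mulVec, Matrix.vecMul_transpose]

/-- Finsler's lemma: a quadratic form that is positive on the kernel of `J` becomes positive
definite after adding a large multiple of `|J d|²`. -/
theorem exists_coercive_add_penalty [DecidableEq n] (Q : Matrix n n ℝ) (J : Matrix m n ℝ)
    (hQ : ∀ d : n → ℝ, d ≠ 0 → J *ᵥ d = 0 → 0 < d ⬝ᵥ (Q *ᵥ d)) :
    ∃ κ > 0, ∃ t > 0, ∀ d : n → ℝ, κ * norm2 d ^ 2 ≤ d ⬝ᵥ (Q *ᵥ d) + t * norm2 (J *ᵥ d) ^ 2 := by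
  let S : Set (EuclideanSpace ℝ n) := Metric.sphere 0 1
  have hS : IsCompact S := isCompact_sphere 0 1
  let q : EuclideanSpace ℝ n → ℝ := fun d => d.ofLp ⬝ᵥ (Q *ᵥ d.ofLp)
  let p : EuclideanSpace ℝ n → ℝ := fun d => norm2 (J *ᵥ d.ofLp) ^ 2
  have hq : Continuous q := by
    have : Continuous fun d : EuclideanSpace ℝ n => d.ofLp := PiLp.continuous_ofLp 2 _
    exact this.dotProduct (continuous_const.matrix_mulVec this)
  have hp : Continuous p := by
    have : Continuous fun d : EuclideanSpace ℝ n => d.ofLp := PiLp.continuous_ofLp 2 _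
    have h2 := continuous_const (y := J) |>.matrix_mulVec this
    simp only [p, norm2_sq]
    exact h2.dotProduct h2
  have key : ∃ N : ℕ, ∀ d ∈ S, 1 / ((N : ℝ) + 1) < q d + ((N : ℝ) + 1) * p d := by
    by_contra hcon
    push Not at hcon
    choose d hdS hd using hcon
    obtain ⟨d₀, hd₀, φ, hφ, hlim⟩ := hS.tendsto_subseq hdS
    have hq' := (hq.tendsto d₀).comp hlim
    have hp' := (hp.tendsto d₀).comp hlim
    have hN : Tendsto (fun i => ((φ i : ℝ) + 1)) atTop atTop :=
      tendsto_atTop_add_const_right _ _ (tendsto_natCast_atTop_atTop.comp hφ.tendsto_atTop)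
    have hN' : Tendsto (fun i => 1 / ((φ i : ℝ) + 1)) atTop (𝓝 0) := by
      simpa [Pi.inv_def] using hN.inv_tendsto_atTop
    have hp0 : ∀ e, 0 ≤ p e := fun e => sq_nonneg _
    have h1 : q d₀ ≤ 0 := by
      refine le_of_tendsto_of_tendsto' hq' hN' fun i => ?_
      have := hd (φ i)
      have h3 : 0 ≤ ((φ i : ℝ) + 1) * p (d (φ i)) := by have := hp0 (d (φ i)); positivity
      simp only [Function.comp]
      linarith
    have h2 : p d₀ ≤ 0 := by
      have h3 : Tendsto (fun i => (1 / ((φ i : ℝ) + 1) - q (d (φ i))) * (1 / ((φ i : ℝ) + 1))) atTop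
          (𝓝 ((0 - q d₀) * 0)) := (hN'.sub hq').mul hN'
      rw [mul_zero] at h3
      refine le_of_tendsto_of_tendsto' hp' h3 fun i => ?_
      have h4 := hd (φ i)
      have h5 : (0 : ℝ) < (φ i : ℝ) + 1 := by positivity
      simp only [Function.comp]
      rw [mul_one_div, le_div_iff₀ h5]
      linarith
    have h6 : J *ᵥ d₀.ofLp = 0 := by
      by_contra hne
      have := norm2_pos hne
      have : 0 < p d₀ := by positivity
      linarith
    have h7 : d₀.ofLp ≠ 0 := by
      intro h0
      have : ‖d₀‖ = 1 := by simpa [S] using hd₀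
      have h8 : d₀ = 0 := by ext i; simpa using congrFun h0 i
      simp [h8] at this
    have := hQ d₀.ofLp h7 h6
    exact absurd h1 (not_le.2 this)
  obtain ⟨N, hN⟩ := key
  refine ⟨1 / ((N : ℝ) + 1), by positivity, (N : ℝ) + 1, by positivity, fun d => ?_⟩
  by_cases hd : d = 0
  · subst hd; simp [norm2]
  have hpos := norm2_pos hd
  have hmem : WithLp.toLp 2 ((norm2 d)⁻¹ • d) ∈ S := by
    have : ‖(WithLp.toLp 2 ((norm2 d)⁻¹ • d) : EuclideanSpace ℝ n)‖ = 1 := by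
      rw [WithLp.toLp_smul, norm_smul]
      rw [Real.norm_of_nonneg (by positivity)]
      exact inv_mul_cancel₀ hpos.ne'
    simpa [S] using this
  have h1 := (hN _ hmem).le
  simp only [q, p, ← dotProduct_transpose_mul_mulVec, dotProduct_mulVec_smul] at h1
  rw [← dotProduct_transpose_mul_mulVec]
  have h2 := mul_le_mul_of_nonneg_right h1 (sq_nonneg (norm2 d))
  refine h2.trans (le_of_eq ?_)
  field_simp

theorem dotProduct_diagonal_form [DecidableEq m] (J : Matrix m n ℝ) (θ : m → ℝ) (d : n → ℝ) :
    d ⬝ᵥ ((Jᵀ * Matrix.diagonal θ * J) *ᵥ d) = ∑ i, θ i * (J *ᵥ d) i ^ 2 := by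
  rw [← Matrix.mulVec_mulVec, ← Matrix.mulVec_mulVec, Matrix.dotProduct_mulVec,
    Matrix.vecMul_transpose]
  simp only [dotProduct, Matrix.mulVec_diagonal]
  exact Finset.sum_congr rfl fun i _ => by ring

theorem coercive_of_le [DecidableEq n] {A : Matrix n n ℝ} {κ : ℝ} (hκ : 0 < κ)
    (hA : ∀ d : n → ℝ, κ * norm2 d ^ 2 ≤ d ⬝ᵥ (A *ᵥ d)) : IsUnit A.det ∧ ‖A⁻¹‖ ≤ κ⁻¹ := by
  have hlow : ∀ d : n → ℝ, κ * norm2 d ≤ norm2 (A *ᵥ d) := by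
    intro d
    by_cases hd : d = 0
    · subst hd; simp [norm2]
    have h1 := (hA d).trans ((le_abs_self _).trans (abs_dotProduct_le d (A *ᵥ d)))
    have := norm2_pos hd
    nlinarith
  have hdet : IsUnit A.det := by
    rw [isUnit_iff_ne_zero]
    intro h0
    obtain ⟨v, hv, hAv⟩ := Matrix.exists_mulVec_eq_zero_iff.2 h0
    have h1 := hlow v
    rw [hAv] at h1
    have h2 := norm2_pos hv
    have h3 : norm2 (0 : n → ℝ) = 0 := by simp [norm2]
    rw [h3] at h1
    have := mul_pos hκ h2
    linarith
  refine ⟨hdet, ?_⟩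
  rw [Matrix.l2_opNorm_def]
  refine ContinuousLinearMap.opNorm_le_bound _ (by positivity) fun v => ?_
  have h := hlow (A⁻¹ *ᵥ v.ofLp)
  rw [Matrix.mulVec_mulVec, Matrix.mul_nonsing_inv _ hdet, Matrix.one_mulVec] at h
  have h2 : norm2 (A⁻¹ *ᵥ v.ofLp) ≤ κ⁻¹ * norm2 v.ofLp := by
    rw [le_inv_mul_iff₀ hκ]; exact h
  exact h2

/-- Matrices `E + Jᵀ Θ J` near the data of the second-order sufficient condition, with large
weights `Θ`, are uniformly coercive. -/
theorem eventually_coercive [DecidableEq m] [DecidableEq n] {E : X → Matrix n n ℝ} {J : X → Matrix m n ℝ}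
    {θ : X → m → ℝ} {W₀ : Matrix n n ℝ} {J₀ : Matrix m n ℝ} (hE : Tendsto E l (𝓝 W₀))
    (hJ : Tendsto J l (𝓝 J₀)) (hθ : ∀ i, Tendsto (fun x => θ x i) l atTop)
    (hQ : ∀ d : n → ℝ, d ≠ 0 → J₀ *ᵥ d = 0 → 0 < d ⬝ᵥ (W₀ *ᵥ d)) :
    ∃ κ > 0, ∀ᶠ x in l, ∀ d : n → ℝ,
      κ * norm2 d ^ 2 ≤ d ⬝ᵥ ((E x + (J x)ᵀ * Matrix.diagonal (θ x) * J x) *ᵥ d) := by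
  obtain ⟨κ, hκ, t, ht, hc⟩ := exists_coercive_add_penalty W₀ J₀ hQ
  have hlim : Tendsto (fun x => E x + t • ((J x)ᵀ * J x)) l (𝓝 (W₀ + t • (J₀ᵀ * J₀))) :=
    hE.add ((((continuous_id.matrix_transpose.matrix_mul continuous_id).tendsto J₀).comp
      hJ).const_smul t)
  refine ⟨κ / 2, by positivity, ?_⟩
  filter_upwards [(Metric.tendsto_nhds.1 hlim) (κ / 2) (by positivity),
    eventually_all.2 fun i => (hθ i).eventually_ge_atTop t] with x hx hθx d
  rw [dist_eq_norm] at hx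
  set D := E x + t • ((J x)ᵀ * J x) - (W₀ + t • (J₀ᵀ * J₀)) with hD
  have h1 : |d ⬝ᵥ (D *ᵥ d)| ≤ κ / 2 * norm2 d ^ 2 := by
    calc |d ⬝ᵥ (D *ᵥ d)| ≤ norm2 d * norm2 (D *ᵥ d) := abs_dotProduct_le _ _
      _ ≤ norm2 d * (‖D‖ * norm2 d) :=
        mul_le_mul_of_nonneg_left (norm2_mulVec_le _ _) (norm2_nonneg _)
      _ = ‖D‖ * norm2 d ^ 2 := by ring
      _ ≤ κ / 2 * norm2 d ^ 2 := mul_le_mul_of_nonneg_right hx.le (sq_nonneg _)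
  have h2 : d ⬝ᵥ (D *ᵥ d) = d ⬝ᵥ (E x *ᵥ d) + t * norm2 (J x *ᵥ d) ^ 2
      - (d ⬝ᵥ (W₀ *ᵥ d) + t * norm2 (J₀ *ᵥ d) ^ 2) := by
    simp only [hD, Matrix.sub_mulVec, Matrix.add_mulVec, Matrix.smul_mulVec, dotProduct_sub,
      dotProduct_add, dotProduct_smul, smul_eq_mul, dotProduct_transpose_mul_mulVec]
  have h3 : t * norm2 (J x *ᵥ d) ^ 2 ≤ ∑ i, θ x i * (J x *ᵥ d) i ^ 2 := by
    rw [norm2_sq, dotProduct, Finset.mul_sum]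
    refine Finset.sum_le_sum fun i _ => ?_
    rw [← sq]
    exact mul_le_mul_of_nonneg_right (hθx i) (sq_nonneg _)
  have h4 := hc d
  rw [Matrix.add_mulVec, dotProduct_add, dotProduct_diagonal_form]
  have h5 := (abs_le.1 h1).1
  linarith

end Coercive

section Spectral

variable {n : ℕ} {m : Type} [Fintype m]

theorem norm2_orthogonal_mulVec {U : Matrix (Fin n) (Fin n) ℝ}
    (hU : U ∈ Matrix.orthogonalGroup (Fin n) ℝ) (c : Fin n → ℝ) : norm2 (U *ᵥ c) = norm2 c := by
  have h : Uᵀ * U = 1 := (Matrix.mem_orthogonalGroup_iff' _ _).1 hU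
  have h2 : norm2 (U *ᵥ c) ^ 2 = norm2 c ^ 2 := by
    rw [← dotProduct_transpose_mul_mulVec, h, Matrix.one_mulVec, norm2_sq]
  exact (sq_eq_sq₀ (norm2_nonneg _) (norm2_nonneg _)).1 h2

theorem transpose_mem_orthogonalGroup {U : Matrix (Fin n) (Fin n) ℝ}
    (hU : U ∈ Matrix.orthogonalGroup (Fin n) ℝ) : Uᵀ ∈ Matrix.orthogonalGroup (Fin n) ℝ := by
  rw [Matrix.mem_orthogonalGroup_iff, Matrix.transpose_transpose]
  exact (Matrix.mem_orthogonalGroup_iff' _ _).1 hU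

/-- A vector whose eigencomponents all belong to eigenvalues of magnitude at least `t` is stretched
at least by the factor `t`. -/
theorem mul_norm2_le_norm2_mulVec {U : Matrix (Fin n) (Fin n) ℝ} {τ : Fin n → ℝ}
    (hU : U ∈ Matrix.orthogonalGroup (Fin n) ℝ) {t : ℝ} (ht : 0 ≤ t) (x : Fin n → ℝ)
    (hx : ∀ k, (Uᵀ *ᵥ x) k ≠ 0 → t ≤ |τ k|) :
    t * norm2 x ≤ norm2 ((U * Matrix.diagonal τ * Uᵀ) *ᵥ x) := by
  rw [← Matrix.mulVec_mulVec, ← Matrix.mulVec_mulVec, norm2_orthogonal_mulVec hU,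
    ← norm2_orthogonal_mulVec (transpose_mem_orthogonalGroup hU) x]
  refine (sq_le_sq₀ (mul_nonneg ht (norm2_nonneg _)) (norm2_nonneg _)).1 ?_
  rw [mul_pow, norm2_sq, norm2_sq, dotProduct, dotProduct, Finset.mul_sum]
  refine Finset.sum_le_sum fun k _ => ?_
  rw [Matrix.mulVec_diagonal]
  by_cases h0 : (Uᵀ *ᵥ x) k = 0
  · simp [h0]
  have h1 : t ^ 2 ≤ τ k ^ 2 := by
    rw [← sq_abs (τ k)]
    exact pow_le_pow_left₀ ht (hx k h0) 2
  have h2 := mul_le_mul_of_nonneg_right h1 (sq_nonneg ((Uᵀ *ᵥ x) k))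
  calc _ = t ^ 2 * (Uᵀ *ᵥ x) k ^ 2 := by ring
    _ ≤ _ := h2
    _ = _ := by ring

/-- Some nonzero combination of the columns of `B` is orthogonal to the first `i` columns of `U`, if
`B` has more than `i` columns. -/
theorem exists_combination_orthogonal (U : Matrix (Fin n) (Fin n) ℝ) (B : Matrix (Fin n) m ℝ)
    (i : Fin n) (hi : i.val < Fintype.card m) :
    ∃ y : m → ℝ, y ≠ 0 ∧ ∀ k, k < i → (Uᵀ *ᵥ (B *ᵥ y)) k = 0 := by
  let T : (m → ℝ) →ₗ[ℝ] ({k : Fin n // k < i} → ℝ) :=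
    ((Uᵀ * B).submatrix (Subtype.val : {k : Fin n // k < i} → Fin n) id).mulVecLin
  have hT : T.ker ≠ ⊥ := LinearMap.ker_ne_bot_of_finrank_lt (by
    simpa [Fintype.card_subtype, Finset.filter_gt_eq_Iio] using hi)
  obtain ⟨y, hy, hy0⟩ := Submodule.exists_mem_ne_zero_of_ne_bot hT
  refine ⟨y, hy0, fun k hk => ?_⟩
  rw [Matrix.mulVec_mulVec]
  exact congrFun (LinearMap.mem_ker.1 hy) ⟨k, hk⟩

/-- Some nonzero combination of the first `j + 1` columns of `U` lies in the kernel of `J`, if `J`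
has at most `j` rows. -/
theorem exists_mem_ker_span {U : Matrix (Fin n) (Fin n) ℝ}
    (hU : U ∈ Matrix.orthogonalGroup (Fin n) ℝ) (J : Matrix m (Fin n) ℝ) (j : Fin n)
    (hj : Fintype.card m ≤ j.val) :
    ∃ x : Fin n → ℝ, x ≠ 0 ∧ J *ᵥ x = 0 ∧ ∀ k, j < k → (Uᵀ *ᵥ x) k = 0 := by
  let V : Matrix (Fin n) {k : Fin n // k ≤ j} ℝ := U.submatrix id Subtype.val
  let T : ({k : Fin n // k ≤ j} → ℝ) →ₗ[ℝ] (m → ℝ) := (J * V).mulVecLin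
  have hT : T.ker ≠ ⊥ := LinearMap.ker_ne_bot_of_finrank_lt (by
    simpa [Fintype.card_subtype, Finset.filter_ge_eq_Iic] using Nat.lt_succ_of_le hj)
  obtain ⟨c, hc, hc0⟩ := Submodule.exists_mem_ne_zero_of_ne_bot hT
  have hUU : Uᵀ * U = 1 := (Matrix.mem_orthogonalGroup_iff' _ _).1 hU
  have hUV : Uᵀ * V = (1 : Matrix (Fin n) (Fin n) ℝ).submatrix id Subtype.val := by
    rw [← hUU]; rfl
  have hcomp : ∀ k, (Uᵀ *ᵥ (V *ᵥ c)) k = ∑ a, (1 : Matrix (Fin n) (Fin n) ℝ) k a.val * c a := by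
    intro k
    rw [Matrix.mulVec_mulVec, hUV]; rfl
  refine ⟨V *ᵥ c, fun h0 => hc0 ?_, ?_, fun k hk => ?_⟩
  · funext a
    have h1 := hcomp a.val
    rw [h0, Matrix.mulVec_zero, Finset.sum_eq_single a] at h1
    · simpa using h1.symm
    · intro b _ hb
      rw [Matrix.one_apply_ne fun h => hb (Subtype.ext h.symm), zero_mul]
    · simp
  · rw [Matrix.mulVec_mulVec]
    exact LinearMap.mem_ker.1 hc
  · rw [hcomp]
    refine Finset.sum_eq_zero fun a _ => ?_
    rw [Matrix.one_apply_ne fun h => absurd a.2 (not_le.2 (by rwa [← h])), zero_mul]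

theorem inv_of_diagonalization {U A : Matrix (Fin n) (Fin n) ℝ} {σ : Fin n → ℝ}
    (hU : U ∈ Matrix.orthogonalGroup (Fin n) ℝ) (hA : A = U * Matrix.diagonal σ * Uᵀ)
    (hdet : IsUnit A.det) :
    (∀ i, σ i ≠ 0) ∧ A⁻¹ = U * Matrix.diagonal (fun i => (σ i)⁻¹) * Uᵀ := by
  have h1 : Uᵀ * U = 1 := (Matrix.mem_orthogonalGroup_iff' _ _).1 hU
  have h2 : U * Uᵀ = 1 := (Matrix.mem_orthogonalGroup_iff _ _).1 hU
  have hσ : ∀ i, σ i ≠ 0 := by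
    intro i hi
    have h3 : A.det = 0 := by
      rw [hA, Matrix.det_mul, Matrix.det_mul, Matrix.det_diagonal,
        Finset.prod_eq_zero (Finset.mem_univ i) hi]
      simp
    exact hdet.ne_zero h3
  refine ⟨hσ, Matrix.inv_eq_right_inv ?_⟩
  have h3 : Matrix.diagonal σ * Matrix.diagonal (fun i => (σ i)⁻¹) = 1 := by
    rw [Matrix.diagonal_mul_diagonal, ← Matrix.diagonal_one]
    congr 1
    funext i
    exact mul_inv_cancel₀ (hσ i)
  calc A * (U * Matrix.diagonal (fun i => (σ i)⁻¹) * Uᵀ)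
      = U * (Matrix.diagonal σ * (Uᵀ * U) * Matrix.diagonal (fun i => (σ i)⁻¹)) * Uᵀ := by
        rw [hA]; simp only [Matrix.mul_assoc]
    _ = 1 := by rw [h1, Matrix.mul_one, h3, Matrix.mul_one, h2]

theorem diagonal_split (l : ℕ) (U : Matrix (Fin n) (Fin n) ℝ) (τ : Fin n → ℝ) (v : Fin n → ℝ) :
    (U * Matrix.diagonal τ * Uᵀ) *ᵥ v =
      colsL l U *ᵥ (diagL l τ *ᵥ ((colsL l U)ᵀ *ᵥ v))
        + colsS l U *ᵥ (diagS l τ *ᵥ ((colsS l U)ᵀ *ᵥ v)) := by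
  rw [← Matrix.mulVec_mulVec, ← Matrix.mulVec_mulVec]
  funext i
  have h := Fintype.sum_subtype_add_sum_subtype (fun k : Fin n => k.val < l)
    (fun k => U i k * (τ k * (Uᵀ *ᵥ v) k))
  simp only [Pi.add_apply, diagL, diagS]
  simp only [Matrix.mulVec, dotProduct, Matrix.diagonal_apply, ite_mul, zero_mul,
    Finset.sum_ite_eq, Finset.mem_univ, if_true, colsL, colsS, Matrix.transpose_apply,
    Matrix.submatrix_apply, id] at h ⊢
  exact h.symm

theorem diag_block_inv {p : Type} [Fintype p] [DecidableEq p] {τ : p → ℝ} (hτ : ∀ i, τ i ≠ 0) :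
    IsUnit (Matrix.diagonal τ).det ∧
      (Matrix.diagonal τ)⁻¹ = Matrix.diagonal fun i => (τ i)⁻¹ := by
  refine ⟨?_, Matrix.inv_eq_right_inv ?_⟩
  · rw [Matrix.det_diagonal, isUnit_iff_ne_zero]
    exact Finset.prod_ne_zero_iff.2 fun i _ => hτ i
  · rw [Matrix.diagonal_mul_diagonal, ← Matrix.diagonal_one]
    congr 1
    funext i
    exact mul_inv_cancel₀ (hτ i)

end Spectral

/-- A family of matrices `E + Jᵀ diag(θ) J` with weights `θ` of order at least `ξ⁻¹`, near data that
satisfy the second-order sufficient condition and the linear independence condition. -/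
structure IsPenaltyFamily {X : Type*} {n m : Type} [Fintype n] [Fintype m] [DecidableEq n]
    (l : Filter X) (ξ : X → ℝ) (E : X → Matrix n n ℝ) (J : X → Matrix m n ℝ)
    (θ : X → m → ℝ) (W₀ : Matrix n n ℝ) (J₀ : Matrix m n ℝ) : Prop where
  tendsto_E : Tendsto E l (𝓝 W₀)
  tendsto_J : Tendsto J l (𝓝 J₀)
  θ_pos : ∀ i, ∀ᶠ x in l, 0 < θ x i
  θ_inv : (fun x i => (θ x i)⁻¹) =O[l] ξ
  tendsto_ξ : Tendsto ξ l (𝓝 0)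
  licq : LinearIndependent ℝ J₀.row
  sosc : ∀ d : n → ℝ, d ≠ 0 → J₀ *ᵥ d = 0 → 0 < d ⬝ᵥ (W₀ *ᵥ d)

/-- The matrix `E + Jᵀ diag(θ) J`. -/
def penaltyMatrix {n m : Type} [Fintype m] [DecidableEq m] (E : Matrix n n ℝ) (J : Matrix m n ℝ)
    (θ : m → ℝ) : Matrix n n ℝ := E + Jᵀ * Matrix.diagonal θ * J

namespace IsPenaltyFamily

variable {X : Type*} {n m : Type} [Fintype n] [Fintype m] [DecidableEq n]
  {l : Filter X} {ξ : X → ℝ} {E : X → Matrix n n ℝ} {J : X → Matrix m n ℝ}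
  {θ : X → m → ℝ} {W₀ : Matrix n n ℝ} {J₀ : Matrix m n ℝ}

theorem tendsto_θ (h : IsPenaltyFamily l ξ E J θ W₀ J₀) (i : m) :
    Tendsto (fun x => θ x i) l atTop := by
  have h1 : Tendsto (fun x => (θ x i)⁻¹) l (𝓝 0) := (isBigO_pi.1 h.θ_inv i).trans_tendsto h.tendsto_ξ
  have h2 : Tendsto (fun x => (θ x i)⁻¹) l (𝓝[>] 0) :=
    tendsto_nhdsWithin_iff.2 ⟨h1, (h.θ_pos i).mono fun x hx => inv_pos.2 hx⟩
  simpa [Pi.inv_def] using h2.inv_tendsto_nhdsGT_zero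

theorem transpose (h : IsPenaltyFamily l ξ E J θ W₀ J₀) :
    IsPenaltyFamily l ξ (fun x => (E x)ᵀ) J θ W₀ᵀ J₀ where
  tendsto_E := (continuous_id.matrix_transpose.tendsto W₀).comp h.tendsto_E
  tendsto_J := h.tendsto_J
  θ_pos := h.θ_pos
  θ_inv := h.θ_inv
  tendsto_ξ := h.tendsto_ξ
  licq := h.licq
  sosc d hd hJ := by
    rw [Matrix.mulVec_transpose, dotProduct_comm, ← Matrix.dotProduct_mulVec]
    exact h.sosc d hd hJ

variable [DecidableEq m]

theorem exists_inv_bound (h : IsPenaltyFamily l ξ E J θ W₀ J₀) : ∃ κ > 0, ∀ᶠ x in l,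
    IsUnit (penaltyMatrix (E x) (J x) (θ x)).det
      ∧ ‖(penaltyMatrix (E x) (J x) (θ x))⁻¹‖ ≤ κ⁻¹ := by
  obtain ⟨κ, hκ, hx⟩ := eventually_coercive h.tendsto_E h.tendsto_J h.tendsto_θ h.sosc
  exact ⟨κ, hκ, hx.mono fun x hx => coercive_of_le hκ hx⟩

theorem eventually_isUnit_det (h : IsPenaltyFamily l ξ E J θ W₀ J₀) :
    ∀ᶠ x in l, IsUnit (penaltyMatrix (E x) (J x) (θ x)).det := by
  obtain ⟨κ, -, hx⟩ := h.exists_inv_bound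
  exact hx.mono fun x hx => hx.1

theorem isBigO_inv (h : IsPenaltyFamily l ξ E J θ W₀ J₀) :
    (fun x => (penaltyMatrix (E x) (J x) (θ x))⁻¹) =O[l] fun _ => (1 : ℝ) := by
  obtain ⟨κ, -, hx⟩ := h.exists_inv_bound
  exact IsBigO.of_bound κ⁻¹ (hx.mono fun x hx => by simpa using hx.2)

/-- If `E Y` and `(E + Jᵀ Θ J) Y` are bounded, then `J Y = O(ξ)`. -/
theorem isBigO_J_mul {k : Type} [Fintype k] [DecidableEq k]
    (h : IsPenaltyFamily l ξ E J θ W₀ J₀) {Y : X → Matrix n k ℝ} (hY : Y =O[l] fun _ => (1 : ℝ))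
    (hAY : (fun x => penaltyMatrix (E x) (J x) (θ x) * Y x) =O[l] fun _ => (1 : ℝ)) :
    (fun x => J x * Y x) =O[l] ξ := by
  have hEY := isBigO_matrix_mul (h.tendsto_E.isBigO_one ℝ) hY
  simp only [one_mul] at hEY
  have h1 : (fun x => (J x)ᵀ * (Matrix.diagonal (θ x) * (J x * Y x))) =O[l]
      fun _ => (1 : ℝ) := by
    refine (hAY.sub hEY).congr_left fun x => ?_
    simp only [penaltyMatrix, Matrix.add_mul, Matrix.mul_assoc, add_sub_cancel_left]
  have h2 := isBigO_of_transpose_mul h.tendsto_J h.licq h1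
  have h3 := isBigO_matrix_mul (isBigO_diagonal h.θ_inv) h2
  simp only [mul_one] at h3
  refine h3.congr' ?_ EventuallyEq.rfl
  filter_upwards [eventually_all.2 h.θ_pos] with x hx
  rw [← Matrix.mul_assoc, Matrix.diagonal_mul_diagonal]
  have : (Matrix.diagonal fun i => (θ x i)⁻¹ * θ x i) = (1 : Matrix m m ℝ) := by
    rw [← Matrix.diagonal_one]
    congr 1
    funext i
    exact inv_mul_cancel₀ (hx i).ne'
  rw [this, Matrix.one_mul]

theorem isBigO_J_mul_inv (h : IsPenaltyFamily l ξ E J θ W₀ J₀) :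
    (fun x => J x * (penaltyMatrix (E x) (J x) (θ x))⁻¹) =O[l] ξ := by
  refine h.isBigO_J_mul h.isBigO_inv ?_
  refine (isBigO_refl (fun _ : X => (1 : Matrix n n ℝ)) l).congr' ?_ EventuallyEq.rfl |>.trans
    (isBigO_const_const _ one_ne_zero l)
  filter_upwards [h.eventually_isUnit_det] with x hx
  rw [Matrix.mul_nonsing_inv _ hx]

theorem isBigO_inv_mul_transpose (h : IsPenaltyFamily l ξ E J θ W₀ J₀) :
    (fun x => (penaltyMatrix (E x) (J x) (θ x))⁻¹ * (J x)ᵀ) =O[l] ξ := by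
  refine (isBigO_transpose h.transpose.isBigO_J_mul_inv).congr_left fun x => ?_
  rw [Matrix.transpose_mul, Matrix.transpose_nonsing_inv]
  simp [penaltyMatrix, Matrix.mul_assoc]

end IsPenaltyFamily

/-- Orthogonal diagonalizations of a penalty family, eigenvalues in decreasing magnitude. -/
structure IsSpectralFamily {X : Type*} {n : ℕ} (l : Filter X)
    (A : X → Matrix (Fin n) (Fin n) ℝ) (U : X → Matrix (Fin n) (Fin n) ℝ) (σ : X → Fin n → ℝ) :
    Prop where
  mem_orthogonal : ∀ᶠ x in l, U x ∈ Matrix.orthogonalGroup (Fin n) ℝ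
  eq : ∀ᶠ x in l, A x = U x * Matrix.diagonal (σ x) * (U x)ᵀ
  antitone : ∀ᶠ x in l, Antitone fun i => |σ x i|

namespace IsSpectralFamily

variable {X : Type*} {n : ℕ} {m : Type} [Fintype m] [DecidableEq m]
  {l : Filter X} {ξ : X → ℝ} {E : X → Matrix (Fin n) (Fin n) ℝ} {J : X → Matrix m (Fin n) ℝ}
  {θ : X → m → ℝ} {W₀ : Matrix (Fin n) (Fin n) ℝ} {J₀ : Matrix m (Fin n) ℝ}
  {U : X → Matrix (Fin n) (Fin n) ℝ} {σ : X → Fin n → ℝ} {A : X → Matrix (Fin n) (Fin n) ℝ}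

theorem isBigO_U (hs : IsSpectralFamily l A U σ) : U =O[l] fun _ => (1 : ℝ) :=
  isBigO_matrix fun i j => IsBigO.of_bound 1 (hs.mem_orthogonal.mono fun x hx => by
    simpa using entry_norm_bound_of_unitary hx i j)

variable (h : IsPenaltyFamily l ξ E J θ W₀ J₀)
  (hs : IsSpectralFamily l (fun x => penaltyMatrix (E x) (J x) (θ x)) U σ)
include h hs

theorem eventually_ne_zero : ∀ᶠ x in l, ∀ i, σ x i ≠ 0 := by
  filter_upwards [h.eventually_isUnit_det, hs.mem_orthogonal, hs.eq] with x h1 h2 h3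
  exact (inv_of_diagonalization h2 h3 h1).1

theorem isBigO_eigenvalue_inv (i : Fin n) : (fun x => (σ x i)⁻¹) =O[l] fun _ => (1 : ℝ) := by
  have h1 := isBigO_matrix_mul (isBigO_matrix_mul (isBigO_transpose hs.isBigO_U) h.isBigO_inv)
    hs.isBigO_U
  simp only [one_mul] at h1
  refine (isBigO_apply h1 i i).congr' ?_ EventuallyEq.rfl
  filter_upwards [h.eventually_isUnit_det, hs.mem_orthogonal, hs.eq] with x h1 h2 h3
  rw [(inv_of_diagonalization h2 h3 h1).2]
  have h4 : (U x)ᵀ * U x = 1 := (Matrix.mem_orthogonalGroup_iff' _ _).1 h2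
  have h5 : (U x)ᵀ * (U x * Matrix.diagonal (fun i => (σ x i)⁻¹) * (U x)ᵀ) * U x
      = ((U x)ᵀ * U x) * Matrix.diagonal (fun i => (σ x i)⁻¹) * ((U x)ᵀ * U x) := by
    simp only [Matrix.mul_assoc]
  rw [h5, h4, Matrix.one_mul, Matrix.mul_one, Matrix.diagonal_apply_eq]

theorem isBigO_large_inv (i : Fin n) (hi : i.val < Fintype.card m) :
    (fun x => (σ x i)⁻¹) =O[l] ξ := by
  obtain ⟨L, hL, hLJ⟩ := exists_leftInverse_transpose h.tendsto_J h.licq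
  have hb := hL.norm_left.mul h.isBigO_inv_mul_transpose.norm_left
  simp only [one_mul] at hb
  refine (IsBigO.of_norm_eventuallyLE ?_).trans hb
  filter_upwards [hLJ, h.eventually_isUnit_det, hs.mem_orthogonal, hs.eq, hs.antitone,
    eventually_ne_zero h hs] with x hx hdet hU hA hanti hne
  obtain ⟨y, hy, hyU⟩ := exists_combination_orthogonal (U x) (J x)ᵀ i hi
  have h1 : |(σ x i)⁻¹| * norm2 ((J x)ᵀ *ᵥ y)
      ≤ norm2 ((penaltyMatrix (E x) (J x) (θ x))⁻¹ *ᵥ ((J x)ᵀ *ᵥ y)) := by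
    rw [(inv_of_diagonalization hU hA hdet).2]
    refine mul_norm2_le_norm2_mulVec hU (abs_nonneg _) _ fun k hk => ?_
    have hik : i ≤ k := not_lt.1 fun hki => hk (hyU k hki)
    rw [abs_inv, abs_inv]
    exact inv_anti₀ (abs_pos.2 (hne k)) (hanti hik)
  have h2 : norm2 y ≤ ‖L x‖ * norm2 ((J x)ᵀ *ᵥ y) := by
    have := norm2_mulVec_le (L x) ((J x)ᵀ *ᵥ y)
    rwa [Matrix.mulVec_mulVec, hx, Matrix.one_mulVec] at this
  rw [Matrix.mulVec_mulVec] at h1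
  have h3 := h1.trans (norm2_mulVec_le _ _)
  have hypos := norm2_pos hy
  rw [Real.norm_eq_abs]
  refine le_of_mul_le_mul_right ?_ hypos
  calc |(σ x i)⁻¹| * norm2 y ≤ |(σ x i)⁻¹| * (‖L x‖ * norm2 ((J x)ᵀ *ᵥ y)) :=
        mul_le_mul_of_nonneg_left h2 (abs_nonneg _)
    _ = ‖L x‖ * (|(σ x i)⁻¹| * norm2 ((J x)ᵀ *ᵥ y)) := by ring
    _ ≤ ‖L x‖ * (‖(penaltyMatrix (E x) (J x) (θ x))⁻¹ * (J x)ᵀ‖ * norm2 y) :=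
        mul_le_mul_of_nonneg_left h3 (norm_nonneg _)
    _ = _ := by ring

theorem isBigO_small (j : Fin n) (hj : Fintype.card m ≤ j.val) :
    (fun x => σ x j) =O[l] fun _ => (1 : ℝ) := by
  refine (IsBigO.of_norm_eventuallyLE ?_).trans (h.tendsto_E.isBigO_one ℝ).norm_left
  filter_upwards [hs.mem_orthogonal, hs.eq, hs.antitone] with x hU hA hanti
  obtain ⟨v, hv, hJv, hvU⟩ := exists_mem_ker_span hU (J x) j hj
  have h1 : |σ x j| * norm2 v ≤ norm2 (penaltyMatrix (E x) (J x) (θ x) *ᵥ v) := by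
    rw [hA]
    refine mul_norm2_le_norm2_mulVec hU (abs_nonneg _) _ fun k hk => ?_
    exact hanti (not_lt.1 fun hki => hk (hvU k hki))
  have h2 : penaltyMatrix (E x) (J x) (θ x) *ᵥ v = E x *ᵥ v := by
    rw [penaltyMatrix, Matrix.add_mulVec, ← Matrix.mulVec_mulVec, hJv, Matrix.mulVec_zero, add_zero]
  rw [h2] at h1
  exact le_of_mul_le_mul_right (h1.trans (norm2_mulVec_le _ _)) (norm2_pos hv)

/-- The small eigenspace is almost orthogonal to the rows of `J`. -/
theorem isBigO_J_mul_colsS (p : ℕ) (hp : Fintype.card m = p) :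
    (fun x => J x * colsS p (U x)) =O[l] ξ := by
  have hUS : (fun x => colsS p (U x)) =O[l] fun _ => (1 : ℝ) :=
    isBigO_matrix fun i j => isBigO_apply hs.isBigO_U i j.val
  refine h.isBigO_J_mul hUS ?_
  have hσ : (fun x => diagS p (σ x)) =O[l] fun _ => (1 : ℝ) :=
    isBigO_diagonal (isBigO_pi.2 fun j => isBigO_small h hs j.val (by have := j.2; omega))
  have h1 := isBigO_matrix_mul hUS hσ
  simp only [one_mul] at h1
  refine h1.congr' ?_ EventuallyEq.rfl
  filter_upwards [hs.mem_orthogonal, hs.eq] with x hU hA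
  have hUU : (U x)ᵀ * U x = 1 := (Matrix.mem_orthogonalGroup_iff' _ _).1 hU
  have h2 : penaltyMatrix (E x) (J x) (θ x) * U x = U x * Matrix.diagonal (σ x) := by
    rw [hA, Matrix.mul_assoc, hUU, Matrix.mul_one]
  funext i j
  have h3 := congrFun (congrFun h2 i) j.val
  rw [Matrix.mul_diagonal] at h3
  rw [diagS, Matrix.mul_diagonal]
  exact h3.symm

end IsSpectralFamily

section ActiveRows

variable {n me mi : ℕ}

theorem sum_indicator_compl_add {p : Type} [Fintype p] (S : Set p) [Fintype S] (f : p → ℝ) :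
    ∑ i, Sᶜ.indicator f i + ∑ i : S, f i = ∑ i, f i := by
  have h : ∑ i : S, f i = ∑ i, S.indicator f i := by
    have := tsum_subtype S f
    rwa [tsum_fintype, tsum_fintype] at this
  rw [h, ← Finset.sum_add_distrib]
  exact Finset.sum_congr rfl fun i _ => congrFun (Set.indicator_compl_add_self S f) i

/-- All rows of `G` and the rows of `H` with index in `S`. -/
def activeRows (S : Set (Fin mi)) (G : Matrix (Fin me) (Fin n) ℝ) (H : Matrix (Fin mi) (Fin n) ℝ) :
    Matrix (Fin me ⊕ S) (Fin n) ℝ :=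
  Matrix.fromRows G (H.submatrix Subtype.val id)

/-- Weights of the rows of `activeRows`. -/
def activeWeights (S : Set (Fin mi)) (d : Fin me → ℝ) (D : Fin mi → ℝ) : Fin me ⊕ S → ℝ :=
  Sum.elim d fun i => D i.val

theorem transpose_mul_diagonal_mul_apply {p q : Type} [Fintype p] [DecidableEq p]
    (A B : Matrix p q ℝ) (θ : p → ℝ) (j k : q) :
    (Aᵀ * Matrix.diagonal θ * B) j k = ∑ i, A i j * θ i * B i k := by
  rw [Matrix.mul_apply]
  exact Finset.sum_congr rfl fun i _ => by rw [Matrix.mul_diagonal, Matrix.transpose_apply]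

theorem assembled_eq_penaltyMatrix (S : Set (Fin mi)) [Fintype S] [DecidableEq S]
    (W R : Matrix (Fin n) (Fin n) ℝ) (G : Matrix (Fin me) (Fin n) ℝ)
    (H : Matrix (Fin mi) (Fin n) ℝ) (D : Fin mi → ℝ) (d : Fin me → ℝ) :
    W + Hᵀ * Matrix.diagonal D * H + Gᵀ * Matrix.diagonal d * G + R =
      penaltyMatrix (W + Hᵀ * Matrix.diagonal (Sᶜ.indicator D) * H + R) (activeRows S G H)
        (activeWeights S d D) := by
  ext j k
  have h := sum_indicator_compl_add S fun i => H i j * D i * H i k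
  have h2 : ∀ i, Sᶜ.indicator (fun i => H i j * D i * H i k) i
      = H i j * Sᶜ.indicator D i * H i k := by
    intro i
    by_cases hi : i ∈ Sᶜ <;> simp [hi]
  simp only [h2] at h
  simp only [penaltyMatrix, Matrix.add_apply, transpose_mul_diagonal_mul_apply,
    Fintype.sum_sum_type, activeRows, Matrix.fromRows_apply_inl, Matrix.fromRows_apply_inr,
    activeWeights, Sum.elim_inl, Sum.elim_inr, Matrix.submatrix_apply, id]
  rw [← h]
  ring

theorem transpose_mulVec_add_eq (S : Set (Fin mi)) [Fintype S]
    (G : Matrix (Fin me) (Fin n) ℝ) (H : Matrix (Fin mi) (Fin n) ℝ) (y : Fin me → ℝ)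
    (t : Fin mi → ℝ) :
    Gᵀ *ᵥ y + Hᵀ *ᵥ t =
      (activeRows S G H)ᵀ *ᵥ activeWeights S y t + Hᵀ *ᵥ (Sᶜ.indicator t) := by
  funext j
  have h := sum_indicator_compl_add S fun i => H i j * t i
  simp only [Pi.add_apply, Matrix.mulVec, dotProduct, Matrix.transpose_apply, activeRows,
    activeWeights,
    Fintype.sum_sum_type, Matrix.fromRows_apply_inl, Matrix.fromRows_apply_inr, Sum.elim_inl,
    Sum.elim_inr, Matrix.submatrix_apply, id]
  rw [← h]
  have h2 : ∀ i, Sᶜ.indicator (fun i => H i j * t i) i = H i j * Sᶜ.indicator t i := by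
    intro i
    by_cases hi : i ∈ Sᶜ <;> simp [hi]
  simp only [h2]
  ring

end ActiveRows

section Continuity

variable {n m : ℕ}

theorem continuous_jacobian {φ : Vec n → Vec m} (hφ : ContDiff ℝ 2 φ) :
    Continuous (jacobian φ) := by
  refine continuous_pi fun k => continuous_pi fun j => ?_
  have h1 : Continuous fun x => fderiv ℝ φ x (basisVec j) :=
    (hφ.continuous_fderiv two_ne_zero).clm_apply continuous_const
  exact (continuous_apply k).comp ((PiLp.continuous_ofLp 2 _).comp h1)

theorem continuous_gradient {φ : Vec n → ℝ} (hφ : ContDiff ℝ 2 φ) :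
    Continuous fun x => gradient φ x :=
  (InnerProductSpace.toDual ℝ (Vec n)).symm.continuous.comp (hφ.continuous_fderiv two_ne_zero)

theorem gradient_const_add_inner {E : Type*} [NormedAddCommGroup E] [InnerProductSpace ℝ E]
    [CompleteSpace E] (k : ℝ) (q y : E) : gradient (fun y => k + inner ℝ y q) y = q := by
  refine HasGradientAt.gradient ?_
  rw [hasGradientAt_iff_hasFDerivAt]
  have h : HasFDerivAt (fun y : E => k + InnerProductSpace.toDual ℝ E q y)
      (InnerProductSpace.toDual ℝ E q) y :=
    (InnerProductSpace.toDual ℝ E q).hasFDerivAt.const_add k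
  refine h.congr_of_eventuallyEq (Eventually.of_forall fun y' => ?_)
  simp [real_inner_comm]

end Continuity

section Constraints

variable {n me mi : ℕ} (P : NLP n me mi) (w : Point n me mi)

theorem gradY_eq : P.gradY w = P.g w.x := by
  have h : (fun y => P.lagrangian w.x w.s y w.z w.v) = fun y =>
      (P.f w.x + inner ℝ w.z (P.h w.x + w.s) - inner ℝ w.v w.s) + inner ℝ y (P.g w.x) := by
    funext y
    simp only [NLP.lagrangian]; ring
  rw [NLP.gradY, h, gradient_const_add_inner]

theorem gradZ_eq : P.gradZ w = P.h w.x + w.s := by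
  have h : (fun z => P.lagrangian w.x w.s w.y z w.v) = fun z =>
      (P.f w.x + inner ℝ w.y (P.g w.x) - inner ℝ w.v w.s) + inner ℝ z (P.h w.x + w.s) := by
    funext z
    simp only [NLP.lagrangian]; ring
  rw [NLP.gradZ, h, gradient_const_add_inner]

theorem norm_g_le_gradPNorm : ‖P.g w.x‖ ≤ P.gradPNorm w := by
  rw [← gradY_eq]
  refine Real.le_sqrt_of_sq_le ?_
  nlinarith [sq_nonneg ‖P.gradX w‖, sq_nonneg ‖P.gradS w‖, sq_nonneg ‖P.gradZ w‖]

theorem norm_h_add_s_le_gradPNorm : ‖P.h w.x + w.s‖ ≤ P.gradPNorm w := by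
  rw [← gradZ_eq]
  refine Real.le_sqrt_of_sq_le ?_
  nlinarith [sq_nonneg ‖P.gradX w‖, sq_nonneg ‖P.gradS w‖, sq_nonneg ‖P.gradY w‖]

end Constraints

section Distance

variable {n me mi : ℕ} (w w' : Point n me mi)

theorem norm_sub_le_distance : ‖w.x - w'.x‖ ≤ w.distance w' ∧ ‖w.s - w'.s‖ ≤ w.distance w' ∧
    ‖w.y - w'.y‖ ≤ w.distance w' ∧ ‖w.z - w'.z‖ ≤ w.distance w' ∧
    ‖w.v - w'.v‖ ≤ w.distance w' := by
  have h1 := sq_nonneg ‖w.x - w'.x‖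
  have h2 := sq_nonneg ‖w.s - w'.s‖
  have h3 := sq_nonneg ‖w.y - w'.y‖
  have h4 := sq_nonneg ‖w.z - w'.z‖
  have h5 := sq_nonneg ‖w.v - w'.v‖
  refine ⟨?_, ?_, ?_, ?_, ?_⟩ <;> exact Real.le_sqrt_of_sq_le (by linarith)

theorem distance_self : w.distance w = 0 := by simp [Point.distance]

theorem distance_nonneg : 0 ≤ w.distance w' := Real.sqrt_nonneg _

end Distance

/-- A family of iterates and floating-point evaluations, with duality measure `ξ`, approaching a
regular solution `ws` along the filter `l` with `u / ξ → 0`. -/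
structure IsRegime {X : Type*} {n me mi : ℕ} (P : NLP n me mi) (ws : Point n me mi)
    (C α a b M c ε : ℝ) (l : Filter X) (w : X → Point n me mi) (ξ γ μ u : X → ℝ)
    (F : X → FloatEval n me mi) : Prop where
  c2 : P.IsC2
  regular : P.IsRegularSolution ws
  α_pos : 0 < α
  a_pos : 0 < a
  ξ_eq : ∀ x, ξ x = (w x).dualityMeasure
  tendsto_distance : Tendsto (fun x => (w x).distance ws) l (𝓝 0)
  tendsto_u_div : Tendsto (fun x => u x / ξ x) l (𝓝 0)
  central : ∀ᶠ x in l, P.IsCentral C α (w x)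
  le_γ : ∀ᶠ x in l, a / ξ x ≤ γ x
  γ_le : ∀ᶠ x in l, γ x ≤ b / ξ x
  ξ_pos : ∀ᶠ x in l, 0 < ξ x
  μ_nonneg : ∀ᶠ x in l, 0 ≤ μ x
  μ_le : ∀ᶠ x in l, μ x ≤ M * ξ x
  u_pos : ∀ᶠ x in l, 0 < u x
  valid : ∀ᶠ x in l, (F x).IsValid P (w x) (γ x) (μ x) (u x) c ε

theorem isBigO_sub_of_isRounding {X : Type*} {l : Filter X} {u A B : X → ℝ}
    (h : ∀ᶠ x in l, IsRounding (u x) (A x) (B x)) :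
    (fun x => B x - A x) =O[l] fun x => u x * A x := by
  refine IsBigO.of_bound 1 (h.mono fun x hx => ?_)
  obtain ⟨τ, hτ, hB⟩ := hx
  rw [hB, one_mul, show A x * (1 + τ) - A x = τ * A x by ring, norm_mul, norm_mul]
  exact mul_le_mul_of_nonneg_right (hτ.trans (le_abs_self _)) (norm_nonneg _)

theorem isBigO_of_le_const_mul {X : Type*} {l : Filter X} {E : Type*} [NormedAddCommGroup E]
    {A : X → E} {u : X → ℝ} {c : ℝ} (h : ∀ᶠ x in l, ‖A x‖ ≤ c * u x) : A =O[l] u :=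
  (IsBigO.of_norm_eventuallyLE h).trans ((isBigO_refl u l).const_mul_left c)

theorem isBigO_ofLp {X : Type*} {l : Filter X} {p : Type} [Fintype p]
    {A : X → EuclideanSpace ℝ p} {f : X → ℝ} (h : A =O[l] f) : (fun x => (A x).ofLp) =O[l] f :=
  isBigO_linearMap (WithLp.linearEquiv 2 ℝ (p → ℝ)).toLinearMap h

theorem tendsto_ofLp_apply {X : Type*} {l : Filter X} {p : Type} [Fintype p]
    {A : X → EuclideanSpace ℝ p} {A₀ : EuclideanSpace ℝ p} (h : Tendsto A l (𝓝 A₀)) (i : p) :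
    Tendsto (fun x => A x i) l (𝓝 (A₀ i)) :=
  (((continuous_apply i).comp (PiLp.continuous_ofLp 2 _)).tendsto A₀).comp h

namespace IsRegime

variable {X : Type*} {n me mi : ℕ} {P : NLP n me mi} {ws : Point n me mi}
  {C α a b M c ε : ℝ} {l : Filter X} {w : X → Point n me mi} {ξ γ μ u : X → ℝ}
  {F : X → FloatEval n me mi} (h : IsRegime P ws C α a b M c ε l w ξ γ μ u F)
include h

theorem tendsto_of_norm_le {E : Type*} [NormedAddCommGroup E] {A : X → E} {A₀ : E}
    (hA : ∀ x, ‖A x - A₀‖ ≤ (w x).distance ws) : Tendsto A l (𝓝 A₀) :=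
  tendsto_iff_norm_sub_tendsto_zero.2 (squeeze_zero (fun _ => norm_nonneg _) hA h.tendsto_distance)

theorem tendsto_x : Tendsto (fun x => (w x).x) l (𝓝 ws.x) :=
  h.tendsto_of_norm_le fun x => (norm_sub_le_distance (w x) ws).1

theorem tendsto_s (i : Fin mi) : Tendsto (fun x => (w x).s i) l (𝓝 (ws.s i)) :=
  tendsto_ofLp_apply (h.tendsto_of_norm_le fun x => (norm_sub_le_distance (w x) ws).2.1) i

theorem tendsto_y (i : Fin me) : Tendsto (fun x => (w x).y i) l (𝓝 (ws.y i)) :=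
  tendsto_ofLp_apply (h.tendsto_of_norm_le fun x => (norm_sub_le_distance (w x) ws).2.2.1) i

theorem tendsto_z (i : Fin mi) : Tendsto (fun x => (w x).z i) l (𝓝 (ws.z i)) :=
  tendsto_ofLp_apply (h.tendsto_of_norm_le fun x => (norm_sub_le_distance (w x) ws).2.2.2.1) i

theorem tendsto_v (i : Fin mi) : Tendsto (fun x => (w x).v i) l (𝓝 (ws.v i)) :=
  tendsto_ofLp_apply (h.tendsto_of_norm_le fun x => (norm_sub_le_distance (w x) ws).2.2.2.2) i

theorem tendsto_ξ : Tendsto ξ l (𝓝 0) := by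
  have h1 : Tendsto (fun x => (∑ i, (w x).s i * (w x).v i) / (mi : ℝ)) l
      (𝓝 ((∑ i, ws.s i * ws.v i) / (mi : ℝ))) :=
    (tendsto_finsetSum _ fun i _ => (h.tendsto_s i).mul (h.tendsto_v i)).div_const _
  simp only [h.regular.kkt.complementarity, Finset.sum_const_zero, zero_div] at h1
  exact h1.congr fun x => (h.ξ_eq x).symm

theorem tendsto_G : Tendsto (fun x => P.G (w x)) l (𝓝 (P.G ws)) :=
  ((continuous_jacobian h.c2.2.1).tendsto ws.x).comp h.tendsto_x

theorem tendsto_H : Tendsto (fun x => P.H (w x)) l (𝓝 (P.H ws)) :=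
  ((continuous_jacobian h.c2.2.2).tendsto ws.x).comp h.tendsto_x

theorem tendsto_gradf : Tendsto (fun x => gradient P.f (w x).x) l (𝓝 (gradient P.f ws.x)) :=
  ((continuous_gradient h.c2.1).tendsto ws.x).comp h.tendsto_x

theorem tendsto_h : Tendsto (fun x => P.h (w x).x) l (𝓝 (P.h ws.x)) :=
  (h.c2.2.2.continuous.tendsto ws.x).comp h.tendsto_x

theorem tendsto_W : Tendsto (fun x => P.W (w x)) l (𝓝 (P.W ws)) := by
  obtain ⟨r, hr, Λ, hΛ⟩ := h.regular.lipschitz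
  refine tendsto_iff_norm_sub_tendsto_zero.2 ?_
  have h1 : Tendsto (fun x => Λ * (w x).distance ws) l (𝓝 0) := by
    simpa using h.tendsto_distance.const_mul Λ
  refine squeeze_zero' (Eventually.of_forall fun _ => norm_nonneg _) ?_ h1
  filter_upwards [h.tendsto_distance.eventually_le_const hr] with x hx
  exact hΛ _ _ hx (by rw [distance_self]; exact hr.le)

/-! Orders of the scalars. -/

theorem ξ_isBigO_one : ξ =O[l] fun _ => (1 : ℝ) := h.tendsto_ξ.isBigO_one ℝ

theorem mul_inv_eq (f : X → ℝ) : (fun x => f x * ξ x * (ξ x)⁻¹) =ᶠ[l] f := by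
  filter_upwards [h.ξ_pos] with x hx
  rw [mul_assoc, mul_inv_cancel₀ hx.ne', mul_one]

theorem inv_mul_eq (f : X → ℝ) : (fun x => f x * (ξ x)⁻¹ * ξ x) =ᶠ[l] f := by
  filter_upwards [h.ξ_pos] with x hx
  rw [mul_assoc, inv_mul_cancel₀ hx.ne', mul_one]

theorem isBigO_mul_ξ_inv (f : X → ℝ) : f =O[l] fun x => f x * (ξ x)⁻¹ := by
  refine (((isBigO_refl (fun x => f x * (ξ x)⁻¹) l).mul h.ξ_isBigO_one).congr'
    (h.inv_mul_eq f) (Eventually.of_forall fun x => ?_))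
  simp

theorem isBigO_mul_ξ (f : X → ℝ) : (fun x => f x * ξ x) =O[l] f :=
  ((isBigO_refl f l).mul h.ξ_isBigO_one).congr_right fun _ => mul_one _

theorem one_isBigO : (fun _ => (1 : ℝ)) =O[l] fun x => (ξ x)⁻¹ :=
  (h.isBigO_mul_ξ_inv fun _ => 1).congr_right fun _ => one_mul _

theorem u_mul_inv_isBigO_one : (fun x => u x * (ξ x)⁻¹) =O[l] fun _ => (1 : ℝ) :=
  h.tendsto_u_div.isBigO_one ℝ

theorem u_isBigO_ξ : u =O[l] ξ :=
  ((h.u_mul_inv_isBigO_one.mul (isBigO_refl ξ l)).congr' (h.inv_mul_eq u)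
    (Eventually.of_forall fun _ => one_mul _))

theorem u_isBigO_one : u =O[l] fun _ => (1 : ℝ) := h.u_isBigO_ξ.trans h.ξ_isBigO_one

theorem tendsto_u : Tendsto u l (𝓝 0) := h.u_isBigO_ξ.trans_tendsto h.tendsto_ξ

theorem γ_pos : ∀ᶠ x in l, 0 < γ x := by
  filter_upwards [h.le_γ, h.ξ_pos] with x h1 h2
  exact (div_pos h.a_pos h2).trans_le h1

theorem γ_isBigO : γ =O[l] fun x => (ξ x)⁻¹ := by
  refine isBigO_of_le_const_mul (c := b) ?_
  filter_upwards [h.γ_pos, h.γ_le] with x h1 h2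
  rwa [Real.norm_of_nonneg h1.le, ← div_eq_mul_inv]

theorem γ_inv_isBigO : (fun x => (γ x)⁻¹) =O[l] ξ := by
  refine isBigO_of_le_const_mul (c := a⁻¹) ?_
  filter_upwards [h.γ_pos, h.le_γ, h.ξ_pos] with x h1 h2 h3
  rw [Real.norm_of_nonneg (inv_pos.2 h1).le]
  refine (inv_anti₀ (div_pos h.a_pos h3) h2).trans (le_of_eq ?_)
  rw [inv_div, div_eq_inv_mul]

theorem μ_isBigO : μ =O[l] ξ := by
  refine isBigO_of_le_const_mul (c := M) ?_
  filter_upwards [h.μ_nonneg, h.μ_le] with x h1 h2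
  rwa [Real.norm_of_nonneg h1]

theorem s_mul_v_isBigO (i : Fin mi) : (fun x => (w x).s i * (w x).v i) =O[l] ξ := by
  refine isBigO_of_le_const_mul (c := mi) ?_
  filter_upwards [h.central] with x hx
  have hp : ∀ j, 0 ≤ (w x).s j * (w x).v j := fun j =>
    (mul_pos (hx.slack_pos j) (hx.mult_pos j)).le
  rw [Real.norm_of_nonneg (hp i), h.ξ_eq, Point.dualityMeasure,
    mul_div_cancel₀ _ (by have := i.pos; positivity)]
  exact Finset.single_le_sum (f := fun j => (w x).s j * (w x).v j) (fun j _ => hp j)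
    (Finset.mem_univ i)

theorem s_mul_v_inv_isBigO (i : Fin mi) :
    (fun x => ((w x).s i * (w x).v i)⁻¹) =O[l] fun x => (ξ x)⁻¹ := by
  refine isBigO_of_le_const_mul (c := α⁻¹) ?_
  filter_upwards [h.central, h.ξ_pos] with x hx hξ
  have hp := mul_pos (hx.slack_pos i) (hx.mult_pos i)
  rw [Real.norm_of_nonneg (inv_pos.2 hp).le, ← mul_inv]
  refine inv_anti₀ (mul_pos h.α_pos hξ) ?_
  rw [h.ξ_eq]
  exact hx.products i

/-! Slacks, multipliers and weights of the active constraints. -/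

theorem sol_v_pos {i : Fin mi} (hi : i ∈ P.activeSet ws.x) : 0 < ws.v i := by
  have h1 := congrArg (fun q : Vec mi => q i) h.regular.kkt.multiplier
  simp only [PiLp.sub_apply, PiLp.zero_apply] at h1
  have := h.regular.scs i hi
  linarith

theorem sol_s_pos {i : Fin mi} (hi : i ∉ P.activeSet ws.x) : 0 < ws.s i := by
  have h1 := congrArg (fun q : Vec mi => q i) h.regular.kkt.inequality
  simp only [PiLp.add_apply, PiLp.zero_apply] at h1
  refine lt_of_le_of_ne (h.regular.kkt.slack_nonneg i) fun h0 => hi ?_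
  show P.h ws.x i = 0
  linarith

theorem v_inv_active {i : Fin mi} (hi : i ∈ P.activeSet ws.x) :
    (fun x => ((w x).v i)⁻¹) =O[l] fun _ => (1 : ℝ) :=
  ((h.tendsto_v i).inv₀ (h.sol_v_pos hi).ne').isBigO_one ℝ

theorem s_inv_inactive {i : Fin mi} (hi : i ∉ P.activeSet ws.x) :
    (fun x => ((w x).s i)⁻¹) =O[l] fun _ => (1 : ℝ) :=
  ((h.tendsto_s i).inv₀ (h.sol_s_pos hi).ne').isBigO_one ℝ

theorem s_inv_isBigO (i : Fin mi) : (fun x => ((w x).s i)⁻¹) =O[l] fun x => (ξ x)⁻¹ := by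
  have h1 := (h.s_mul_v_inv_isBigO i).mul ((h.tendsto_v i).isBigO_one ℝ)
  simp only [mul_one] at h1
  refine h1.congr' ?_ EventuallyEq.rfl
  filter_upwards [h.central] with x hx
  have := hx.slack_pos i
  have := hx.mult_pos i
  field_simp

theorem Ds_pos (i : Fin mi) : ∀ᶠ x in l, 0 < (w x).Ds i :=
  h.central.mono fun _ hx => div_pos (hx.mult_pos i) (hx.slack_pos i)

theorem Ds_isBigO (i : Fin mi) : (fun x => (w x).Ds i) =O[l] fun x => (ξ x)⁻¹ := by
  have h1 := ((h.tendsto_v i).isBigO_one ℝ).mul (h.s_inv_isBigO i)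
  exact h1.congr (fun _ => rfl) fun _ => one_mul _

theorem Ds_inactive {i : Fin mi} (hi : i ∉ P.activeSet ws.x) :
    (fun x => (w x).Ds i) =O[l] ξ := by
  have h1 := (h.s_mul_v_isBigO i).mul ((h.s_inv_inactive hi).mul (h.s_inv_inactive hi))
  simp only [mul_one] at h1
  refine h1.congr' ?_ EventuallyEq.rfl
  filter_upwards [h.central] with x hx
  have := hx.slack_pos i
  simp only [Point.Ds]
  field_simp

theorem Ds_inv_active {i : Fin mi} (hi : i ∈ P.activeSet ws.x) :
    (fun x => ((w x).Ds i)⁻¹) =O[l] ξ := by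
  have h1 := (h.s_mul_v_isBigO i).mul ((h.v_inv_active hi).mul (h.v_inv_active hi))
  simp only [mul_one] at h1
  refine h1.congr' ?_ EventuallyEq.rfl
  filter_upwards [h.central] with x hx
  have := hx.mult_pos i
  simp only [Point.Ds]
  field_simp

theorem g_isBigO : (fun x => P.g (w x).x) =O[l] ξ := by
  refine isBigO_of_le_const_mul (c := C) (h.central.mono fun x hx => ?_)
  rw [h.ξ_eq]
  exact (norm_g_le_gradPNorm P (w x)).trans hx.residual

theorem r4_isBigO (i : Fin mi) : (fun x => P.r4 (w x) i) =O[l] ξ := by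
  have h1 : (fun x => P.h (w x).x + (w x).s) =O[l] ξ := by
    refine isBigO_of_le_const_mul (c := C) (h.central.mono fun x hx => ?_)
    rw [h.ξ_eq]
    exact (norm_h_add_s_le_gradPNorm P (w x)).trans hx.residual
  exact isBigO_pi.1 (isBigO_ofLp h1) i

/-! Computed data. -/

theorem gradf_err : (fun x => (F x).gradf - gradient P.f (w x).x) =O[l] u :=
  isBigO_of_le_const_mul (h.valid.mono fun _ hx => hx.gradf_err)

theorem g_err : (fun x => (F x).g - P.g (w x).x) =O[l] u :=
  isBigO_of_le_const_mul (h.valid.mono fun _ hx => hx.g_err)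

theorem h_err : (fun x => (F x).h - P.h (w x).x) =O[l] u :=
  isBigO_of_le_const_mul (h.valid.mono fun _ hx => hx.h_err)

theorem G_err : (fun x => (F x).G - P.G (w x)) =O[l] u :=
  isBigO_of_le_const_mul (h.valid.mono fun _ hx => hx.G_err)

theorem H_err : (fun x => (F x).H - P.H (w x)) =O[l] u :=
  isBigO_of_le_const_mul (h.valid.mono fun _ hx => hx.H_err)

theorem W_err : (fun x => (F x).W - P.W (w x)) =O[l] u :=
  isBigO_of_le_const_mul (h.valid.mono fun _ hx => hx.W_err)

theorem tendsto_of_err {E : Type*} [NormedAddCommGroup E] {A B : X → E} {A₀ : E}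
    (hAB : (fun x => B x - A x) =O[l] u) (hA : Tendsto A l (𝓝 A₀)) : Tendsto B l (𝓝 A₀) := by
  simpa using (hAB.trans_tendsto h.tendsto_u).add hA

theorem tendsto_FG : Tendsto (fun x => (F x).G) l (𝓝 (P.G ws)) :=
  h.tendsto_of_err h.G_err h.tendsto_G

theorem tendsto_FH : Tendsto (fun x => (F x).H) l (𝓝 (P.H ws)) :=
  h.tendsto_of_err h.H_err h.tendsto_H

theorem tendsto_FW : Tendsto (fun x => (F x).W) l (𝓝 (P.W ws)) :=
  h.tendsto_of_err h.W_err h.tendsto_W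

theorem Fg_isBigO : (fun x => (F x).g) =O[l] ξ :=
  ((h.g_err.trans h.u_isBigO_ξ).add h.g_isBigO).congr_left fun _ => sub_add_cancel _ _

theorem FDs_err (i : Fin mi) :
    (fun x => (F x).Ds i - (w x).Ds i) =O[l] fun x => u x * (w x).Ds i :=
  isBigO_sub_of_isRounding (h.valid.mono fun _ hx => hx.Ds_round i)

theorem FDs_err_inactive {i : Fin mi} (hi : i ∉ P.activeSet ws.x) :
    (fun x => (F x).Ds i - (w x).Ds i) =O[l] fun x => u x * ξ x :=
  (h.FDs_err i).trans ((isBigO_refl u l).mul (h.Ds_inactive hi))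

theorem FDs_err_le (i : Fin mi) :
    (fun x => (F x).Ds i - (w x).Ds i) =O[l] fun x => u x * (ξ x)⁻¹ :=
  (h.FDs_err i).trans ((isBigO_refl u l).mul (h.Ds_isBigO i))

theorem FDs_isBigO (i : Fin mi) : (fun x => (F x).Ds i) =O[l] fun x => (ξ x)⁻¹ :=
  (((h.FDs_err_le i).trans (h.u_mul_inv_isBigO_one.trans h.one_isBigO)).add
    (h.Ds_isBigO i)).congr_left fun _ => sub_add_cancel _ _

theorem FDs_inactive {i : Fin mi} (hi : i ∉ P.activeSet ws.x) :
    (fun x => (F x).Ds i) =O[l] ξ :=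
  ((((h.FDs_err_inactive hi).trans (h.isBigO_mul_ξ u)).trans h.u_isBigO_ξ).add
    (h.Ds_inactive hi)).congr_left fun _ => sub_add_cancel _ _

/-- A rounded positive quantity stays positive and of the same order. -/
theorem rounding_pos_inv {A B : X → ℝ} (hA : ∀ᶠ x in l, 0 < A x)
    (hAB : ∀ᶠ x in l, IsRounding (u x) (A x) (B x)) (hinv : (fun x => (A x)⁻¹) =O[l] ξ) :
    (∀ᶠ x in l, 0 < B x) ∧ (fun x => (B x)⁻¹) =O[l] ξ := by
  have hle : ∀ᶠ x in l, A x / 2 ≤ B x := by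
    filter_upwards [hA, hAB, h.tendsto_u.eventually_le_const (show (0 : ℝ) < 1 / 2 by norm_num)]
      with x h1 h2 h3
    obtain ⟨τ, hτ, hB⟩ := h2
    have := (abs_le.1 (hτ.trans h3)).1
    rw [hB]
    nlinarith
  refine ⟨by filter_upwards [hA, hle] with x h1 h2; linarith, IsBigO.trans ?_ hinv⟩
  refine IsBigO.of_bound 2 ?_
  filter_upwards [hA, hle] with x h1 h2
  have h3 : 0 < A x / 2 := by linarith
  rw [Real.norm_of_nonneg (inv_pos.2 (h3.trans_le h2)).le, Real.norm_of_nonneg (inv_pos.2 h1).le]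
  refine (inv_anti₀ h3 h2).trans (le_of_eq ?_)
  rw [inv_div, div_eq_mul_inv]

theorem FDγ_err (j : Fin me) :
    (fun x => (F x).Dγ j - γ x) =O[l] fun x => u x * (ξ x)⁻¹ :=
  (isBigO_sub_of_isRounding (h.valid.mono fun _ hx => hx.Dγ_round j)).trans
    ((isBigO_refl u l).mul h.γ_isBigO)

theorem FDγ_isBigO (j : Fin me) : (fun x => (F x).Dγ j) =O[l] fun x => (ξ x)⁻¹ :=
  (((h.FDγ_err j).trans (h.u_mul_inv_isBigO_one.trans h.one_isBigO)).add
    h.γ_isBigO).congr_left fun _ => sub_add_cancel _ _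

end IsRegime

theorem NLP.KGamma_eq {n me mi : ℕ} (P : NLP n me mi) (γ : ℝ) (w : Point n me mi) :
    P.KGamma γ w = P.W w + (P.H w)ᵀ * Matrix.diagonal w.Ds * P.H w
      + (P.G w)ᵀ * Matrix.diagonal (fun _ : Fin me => γ) * P.G w + 0 := by
  rw [NLP.KGamma, add_zero, ← Matrix.smul_eq_mul_diagonal, Matrix.smul_mul]

section Congruence

variable {X : Type*} {l : Filter X} {p q : Type} [Fintype p] [Fintype q] [DecidableEq p]
  [DecidableEq q]

theorem isBigO_congruence {A : X → Matrix p q ℝ} {D : X → p → ℝ} {f : X → ℝ}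
    (hA : A =O[l] fun _ => (1 : ℝ)) (hD : D =O[l] f) :
    (fun x => (A x)ᵀ * Matrix.diagonal (D x) * A x) =O[l] f := by
  simpa only [one_mul, mul_one] using
    isBigO_matrix_mul (isBigO_matrix_mul (isBigO_transpose hA) (isBigO_diagonal hD)) hA

theorem isBigO_congruence_sub {A B : X → Matrix p q ℝ} {D D' : X → p → ℝ} {f u v : X → ℝ}
    (hA : A =O[l] fun _ => (1 : ℝ)) (hB : B =O[l] fun _ => (1 : ℝ))
    (hAB : (fun x => B x - A x) =O[l] u) (hD : D =O[l] v) (hD' : D' =O[l] v)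
    (hDD : (fun x => D' x - D x) =O[l] f) (huv : (fun x => u x * v x) =O[l] f) :
    (fun x => (B x)ᵀ * Matrix.diagonal (D' x) * B x - (A x)ᵀ * Matrix.diagonal (D x) * A x)
      =O[l] f := by
  have h1 := isBigO_matrix_mul
    (isBigO_matrix_mul (isBigO_transpose hAB) (isBigO_diagonal hD')) hB
  have h2 := isBigO_matrix_mul
    (isBigO_matrix_mul (isBigO_transpose hA) (isBigO_diagonal hDD)) hB
  have h3 := isBigO_matrix_mul
    (isBigO_matrix_mul (isBigO_transpose hA) (isBigO_diagonal hD)) hAB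
  simp only [one_mul, mul_one] at h1 h2 h3
  have h4 : (fun x => v x * u x) =O[l] f := huv.congr_left fun x => mul_comm _ _
  refine (((h1.trans huv).add h2).add (h3.trans h4)).congr_left fun x => ?_
  have hd : Matrix.diagonal (D' x - D x) = Matrix.diagonal (D' x) - Matrix.diagonal (D x) :=
    (Matrix.diagonal_sub _ _).symm
  rw [hd]
  simp only [Matrix.transpose_sub, Matrix.sub_mul, Matrix.mul_sub]
  abel

end Congruence

namespace IsRegime

variable {X : Type*} {n me mi : ℕ} {P : NLP n me mi} {ws : Point n me mi}
  {C α a b M c ε : ℝ} {l : Filter X} {w : X → Point n me mi} {ξ γ μ u : X → ℝ}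
  {F : X → FloatEval n me mi} (h : IsRegime P ws C α a b M c ε l w ξ γ μ u F)
include h

theorem KGamma_isBigO : (fun x => P.KGamma (γ x) (w x)) =O[l] fun x => (ξ x)⁻¹ := by
  have h1 := isBigO_congruence (h.tendsto_H.isBigO_one ℝ) (isBigO_pi.2 h.Ds_isBigO)
  have h2 := isBigO_congruence (h.tendsto_G.isBigO_one ℝ)
    (isBigO_pi.2 fun _ => h.γ_isBigO : (fun x (_ : Fin me) => γ x) =O[l] _)
  refine (((h.tendsto_W.isBigO_one ℝ).trans h.one_isBigO).add h1 |>.add h2).congr_left fun x => ?_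
  rw [NLP.KGamma_eq, add_zero]

theorem cholErr_isBigO : (fun x => (F x).cholErr) =O[l] fun x => u x * (ξ x)⁻¹ := by
  refine (IsBigO.of_norm_eventuallyLE (h.valid.mono fun _ hx => hx.chol_stable)).trans ?_
  refine (((isBigO_refl u l).mul (isBigO_refl (fun _ => (1 : ℝ)) l)).const_mul_left ε |>.mul
    h.KGamma_isBigO.norm_left).congr (fun x => ?_) fun x => ?_
  · ring
  · ring

theorem KGamma_err :
    (fun x => (F x).KGamma - P.KGamma (γ x) (w x)) =O[l] fun x => u x * (ξ x)⁻¹ := by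
  have h1 := isBigO_congruence_sub (h.tendsto_H.isBigO_one ℝ) (h.tendsto_FH.isBigO_one ℝ) h.H_err
    (isBigO_pi.2 h.Ds_isBigO) (isBigO_pi.2 h.FDs_isBigO) (isBigO_pi.2 h.FDs_err_le)
    (isBigO_refl _ l)
  have h2 := isBigO_congruence_sub (h.tendsto_G.isBigO_one ℝ) (h.tendsto_FG.isBigO_one ℝ) h.G_err
    (isBigO_pi.2 fun _ => h.γ_isBigO : (fun x (_ : Fin me) => γ x) =O[l] _)
    (isBigO_pi.2 h.FDγ_isBigO) (isBigO_pi.2 h.FDγ_err) (isBigO_refl _ l)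
  refine ((((h.W_err.trans (h.isBigO_mul_ξ_inv u)).add h1).add h2).add
    h.cholErr_isBigO).congr_left fun x => ?_
  rw [NLP.KGamma_eq, FloatEval.KGamma]
  abel

omit h in
theorem indicator_isBigO {D : X → Fin mi → ℝ} {f : X → ℝ}
    (hD : ∀ i, i ∉ P.activeSet ws.x → (fun x => D x i) =O[l] f) :
    (fun x => (P.activeSet ws.x)ᶜ.indicator (D x)) =O[l] f := by
  refine isBigO_pi.2 fun i => ?_
  by_cases hi : i ∈ P.activeSet ws.x
  · simpa [hi] using isBigO_zero f l
  · simpa [hi] using hD i hi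

theorem tendsto_base {W' R : X → Matrix (Fin n) (Fin n) ℝ} {H' : X → Matrix (Fin mi) (Fin n) ℝ}
    {D : X → Fin mi → ℝ} (hW : Tendsto W' l (𝓝 (P.W ws))) (hH : Tendsto H' l (𝓝 (P.H ws)))
    (hD : ∀ i, i ∉ P.activeSet ws.x → (fun x => D x i) =O[l] ξ) (hR : Tendsto R l (𝓝 0)) :
    Tendsto (fun x => W' x + (H' x)ᵀ * Matrix.diagonal ((P.activeSet ws.x)ᶜ.indicator (D x)) * H' x
      + R x) l (𝓝 (P.W ws)) := by
  have h1 := (isBigO_congruence (hH.isBigO_one ℝ) (indicator_isBigO hD)).trans_tendsto h.tendsto_ξ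
  simpa using (hW.add h1).add hR

variable [Fintype (P.activeSet ws.x)]

omit h in
theorem activeRows_isBigO {G' : X → Matrix (Fin me) (Fin n) ℝ} {H' : X → Matrix (Fin mi) (Fin n) ℝ}
    {f : X → ℝ} (hG : G' =O[l] f) (hH : H' =O[l] f) :
    (fun x => activeRows (P.activeSet ws.x) (G' x) (H' x)) =O[l] f := by
  refine isBigO_matrix fun i j => ?_
  rcases i with i | i
  · exact isBigO_apply hG i j
  · exact isBigO_apply hH i.val j

omit h [Fintype (P.activeSet ws.x)] in
theorem tendsto_activeRows {G' : X → Matrix (Fin me) (Fin n) ℝ}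
    {H' : X → Matrix (Fin mi) (Fin n) ℝ} (hG : Tendsto G' l (𝓝 (P.G ws)))
    (hH : Tendsto H' l (𝓝 (P.H ws))) :
    Tendsto (fun x => activeRows (P.activeSet ws.x) (G' x) (H' x)) l
      (𝓝 (activeRows (P.activeSet ws.x) (P.G ws) (P.H ws))) := by
  refine tendsto_pi_nhds.2 fun i => tendsto_pi_nhds.2 fun j => ?_
  rcases i with i | i
  · exact tendsto_pi_nhds.1 (tendsto_pi_nhds.1 hG i) j
  · exact tendsto_pi_nhds.1 (tendsto_pi_nhds.1 hH i.val) j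

theorem penaltyFamily :
    IsPenaltyFamily l ξ
      (fun x => P.W (w x) + (P.H (w x))ᵀ
        * Matrix.diagonal ((P.activeSet ws.x)ᶜ.indicator (w x).Ds) * P.H (w x) + 0)
      (fun x => activeRows (P.activeSet ws.x) (P.G (w x)) (P.H (w x)))
      (fun x => activeWeights (P.activeSet ws.x) (fun _ => γ x) (w x).Ds)
      (P.W ws) (activeRows (P.activeSet ws.x) (P.G ws) (P.H ws)) where
  tendsto_E := h.tendsto_base h.tendsto_W h.tendsto_H (fun _ hi => h.Ds_inactive hi)
    tendsto_const_nhds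
  tendsto_J := tendsto_activeRows h.tendsto_G h.tendsto_H
  θ_pos i := by
    rcases i with i | i
    · exact h.γ_pos
    · exact h.Ds_pos i.val
  θ_inv := isBigO_pi.2 fun i => by
    rcases i with i | i
    · exact h.γ_inv_isBigO
    · exact h.Ds_inv_active i.2
  tendsto_ξ := h.tendsto_ξ
  licq := h.regular.licq
  sosc := h.regular.sosc

theorem penaltyFamily_computed :
    IsPenaltyFamily l ξ
      (fun x => (F x).W + ((F x).H)ᵀ
        * Matrix.diagonal ((P.activeSet ws.x)ᶜ.indicator (F x).Ds) * (F x).H + (F x).cholErr)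
      (fun x => activeRows (P.activeSet ws.x) (F x).G (F x).H)
      (fun x => activeWeights (P.activeSet ws.x) (F x).Dγ (F x).Ds)
      (P.W ws) (activeRows (P.activeSet ws.x) (P.G ws) (P.H ws)) where
  tendsto_E := h.tendsto_base h.tendsto_FW h.tendsto_FH (fun _ hi => h.FDs_inactive hi)
    (h.cholErr_isBigO.trans_tendsto (by simpa only [div_eq_mul_inv] using h.tendsto_u_div))
  tendsto_J := tendsto_activeRows h.tendsto_FG h.tendsto_FH
  θ_pos i := by
    rcases i with i | i
    · exact (h.rounding_pos_inv h.γ_pos (h.valid.mono fun _ hx => hx.Dγ_round i) h.γ_inv_isBigO).1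
    · exact (h.rounding_pos_inv (h.Ds_pos i.val) (h.valid.mono fun _ hx => hx.Ds_round i.val)
        (h.Ds_inv_active i.2)).1
  θ_inv := isBigO_pi.2 fun i => by
    rcases i with i | i
    · exact (h.rounding_pos_inv h.γ_pos (h.valid.mono fun _ hx => hx.Dγ_round i) h.γ_inv_isBigO).2
    · exact (h.rounding_pos_inv (h.Ds_pos i.val) (h.valid.mono fun _ hx => hx.Ds_round i.val)
        (h.Ds_inv_active i.2)).2
  tendsto_ξ := h.tendsto_ξ
  licq := h.regular.licq
  sosc := h.regular.sosc

variable [DecidableEq (P.activeSet ws.x)]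

omit h in
theorem KGamma_eq_penaltyMatrix (γ : ℝ) (w : Point n me mi) :
    P.KGamma γ w = penaltyMatrix (P.W w + (P.H w)ᵀ
        * Matrix.diagonal ((P.activeSet ws.x)ᶜ.indicator w.Ds) * P.H w + 0)
      (activeRows (P.activeSet ws.x) (P.G w) (P.H w))
      (activeWeights (P.activeSet ws.x) (fun _ => γ) w.Ds) := by
  rw [NLP.KGamma_eq, assembled_eq_penaltyMatrix (P.activeSet ws.x)]

omit h in
theorem computed_eq_penaltyMatrix (F : FloatEval n me mi) :
    F.KGamma = penaltyMatrix (F.W + (F.H)ᵀ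
        * Matrix.diagonal ((P.activeSet ws.x)ᶜ.indicator F.Ds) * F.H + F.cholErr)
      (activeRows (P.activeSet ws.x) F.G F.H)
      (activeWeights (P.activeSet ws.x) F.Dγ F.Ds) := by
  rw [FloatEval.KGamma, assembled_eq_penaltyMatrix (P.activeSet ws.x)]

end IsRegime

namespace IsRegime

variable {X : Type*} {n me mi : ℕ} {P : NLP n me mi} {ws : Point n me mi}
  {C α a b M c ε : ℝ} {l : Filter X} {w : X → Point n me mi} {ξ γ μ u : X → ℝ}
  {F : X → FloatEval n me mi} (h : IsRegime P ws C α a b M c ε l w ξ γ μ u F)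
include h

/-! Right-hand sides. -/

theorem μ_div_s_isBigO (i : Fin mi) : (fun x => μ x / (w x).s i) =O[l] fun _ => (1 : ℝ) := by
  refine (h.μ_isBigO.mul (h.s_inv_isBigO i)).congr' (Eventually.of_forall fun x => ?_) ?_
  · exact (div_eq_mul_inv _ _).symm
  · filter_upwards [h.ξ_pos] with x hx
    exact mul_inv_cancel₀ hx.ne'

theorem z_isBigO (i : Fin mi) : (fun x => (w x).z i) =O[l] fun _ => (1 : ℝ) :=
  (h.tendsto_z i).isBigO_one ℝ

theorem r2_isBigO (i : Fin mi) : (fun x => P.r2 (μ x) (w x) i) =O[l] fun _ => (1 : ℝ) :=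
  (h.z_isBigO i).sub (h.μ_div_s_isBigO i)

theorem r2_err (i : Fin mi) : (fun x => (F x).r2 i - P.r2 (μ x) (w x) i) =O[l] u := by
  have h1 : (fun x => u x * (|μ x / (w x).s i| + (|(w x).z i| + |μ x / (w x).s i| * (1 + u x))))
      =O[l] u := by
    have hm := h.μ_div_s_isBigO i
    have hu := (isBigO_refl (fun _ : X => (1 : ℝ)) l).add h.u_isBigO_one
    have h2 := hm.norm_left.mul hu
    simp only [mul_one] at h2
    have h3 := (isBigO_refl u l).mul (hm.norm_left.add ((h.z_isBigO i).norm_left.add h2))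
    exact h3.congr_right fun _ => mul_one _
  refine (IsBigO.of_norm_eventuallyLE ?_).trans h1
  filter_upwards [h.valid, h.u_pos] with x hx hu
  obtain ⟨q, ⟨τ, hτ, hq⟩, τ', hτ', hF⟩ := hx.r2_round i
  have e1 : (F x).r2 i - P.r2 (μ x) (w x) i = -(μ x / (w x).s i * τ) + ((w x).z i - q) * τ' := by
    simp only [NLP.r2]
    rw [hF, hq]; ring
  have hq' : |q| ≤ |μ x / (w x).s i| * (1 + u x) := by
    rw [hq, abs_mul]
    refine mul_le_mul_of_nonneg_left ((abs_add_le _ _).trans ?_) (abs_nonneg _)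
    rw [abs_one]; linarith
  rw [e1, Real.norm_eq_abs]
  refine (abs_add_le _ _).trans ?_
  rw [abs_neg, abs_mul, abs_mul, mul_add, mul_comm (u x), mul_comm (u x)]
  refine add_le_add (mul_le_mul_of_nonneg_left hτ (abs_nonneg _)) ?_
  refine mul_le_mul ((abs_sub _ _).trans (by linarith)) hτ' (abs_nonneg _) ?_
  exact add_nonneg (abs_nonneg _) ((abs_nonneg q).trans hq')

theorem r4_err (i : Fin mi) : (fun x => (F x).r4 i - P.r4 (w x) i) =O[l] u := by
  have h1 : (fun x => (F x).h i - P.h (w x).x i) =O[l] u := isBigO_pi.1 (isBigO_ofLp h.h_err) i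
  have h2 : (fun x => (F x).h i + (w x).s i) =O[l] fun _ => (1 : ℝ) :=
    (tendsto_ofLp_apply (h.tendsto_of_err h.h_err h.tendsto_h) i).isBigO_one ℝ |>.add
      ((h.tendsto_s i).isBigO_one ℝ)
  have h3 := (isBigO_sub_of_isRounding (h.valid.mono fun _ hx => hx.r4_round i)).trans
    ((isBigO_refl u l).mul h2)
  simp only [mul_one] at h3
  refine (h3.add h1).congr_left fun x => ?_
  simp only [NLP.r4]; ring

theorem Ds_mul_r4_isBigO (i : Fin mi) :
    (fun x => (w x).Ds i * P.r4 (w x) i) =O[l] fun _ => (1 : ℝ) := by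
  refine ((h.Ds_isBigO i).mul (h.r4_isBigO i)).congr' EventuallyEq.rfl ?_
  filter_upwards [h.ξ_pos] with x hx
  exact inv_mul_cancel₀ hx.ne'

theorem inner_isBigO :
    (fun x => (w x).Ds * P.r4 (w x) - P.r2 (μ x) (w x)) =O[l] fun _ => (1 : ℝ) :=
  isBigO_pi.2 fun i => (h.Ds_mul_r4_isBigO i).sub (h.r2_isBigO i)

theorem inner_err_apply {i : Fin mi} {f : X → ℝ} (hu : u =O[l] f)
    (h1 : (fun x => (F x).Ds i * u x) =O[l] f)
    (h2 : (fun x => u x * (w x).Ds i * P.r4 (w x) i) =O[l] f) :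
    (fun x => ((F x).Ds * (F x).r4 - (F x).r2) i
      - ((w x).Ds * P.r4 (w x) - P.r2 (μ x) (w x)) i) =O[l] f := by
  have h3 := ((isBigO_refl (fun x => (F x).Ds i) l).mul (h.r4_err i)).trans h1
  have h4 := ((h.FDs_err i).mul (isBigO_refl (fun x => P.r4 (w x) i) l)).trans h2
  refine ((h3.add h4).sub ((h.r2_err i).trans hu)).congr_left fun x => ?_
  simp only [Pi.sub_apply, Pi.mul_apply]
  ring

theorem u_mul_Ds_mul_r4_isBigO (i : Fin mi) :
    (fun x => u x * (w x).Ds i * P.r4 (w x) i) =O[l] u := by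
  refine ((isBigO_refl u l).mul (h.Ds_mul_r4_isBigO i)).congr (fun x => ?_) fun _ => mul_one _
  ring

theorem inner_err :
    (fun x => ((F x).Ds * (F x).r4 - (F x).r2)
      - ((w x).Ds * P.r4 (w x) - P.r2 (μ x) (w x))) =O[l] fun x => u x * (ξ x)⁻¹ := by
  refine isBigO_pi.2 fun i => h.inner_err_apply (h.isBigO_mul_ξ_inv u) ?_
    ((h.u_mul_Ds_mul_r4_isBigO i).trans (h.isBigO_mul_ξ_inv u))
  exact ((h.FDs_isBigO i).mul (isBigO_refl u l)).congr_right fun x => mul_comm _ _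

theorem inner_err_inactive {i : Fin mi} (hi : i ∉ P.activeSet ws.x) :
    (fun x => (((F x).Ds * (F x).r4 - (F x).r2)
      - ((w x).Ds * P.r4 (w x) - P.r2 (μ x) (w x))) i) =O[l] u := by
  refine h.inner_err_apply (isBigO_refl u l) ?_ (h.u_mul_Ds_mul_r4_isBigO i)
  exact (((h.FDs_inactive hi).trans h.ξ_isBigO_one).mul (isBigO_refl u l)).congr_right
    fun x => one_mul _

theorem computed_inner_isBigO :
    (fun x => (F x).Ds * (F x).r4 - (F x).r2) =O[l] fun _ => (1 : ℝ) :=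
  ((h.inner_err.trans h.u_mul_inv_isBigO_one).add h.inner_isBigO).congr_left
    fun _ => sub_add_cancel _ _

theorem r1_isBigO : (fun x => P.r1 (w x)) =O[l] fun _ => (1 : ℝ) := by
  have h1 := isBigO_mulVec (isBigO_transpose (h.tendsto_G.isBigO_one ℝ))
    (isBigO_pi.2 fun i => (h.tendsto_y i).isBigO_one ℝ)
  have h2 := isBigO_mulVec (isBigO_transpose (h.tendsto_H.isBigO_one ℝ)) (isBigO_pi.2 h.z_isBigO)
  simp only [mul_one] at h1 h2
  exact ((isBigO_ofLp (h.tendsto_gradf.isBigO_one ℝ)).add h1).add h2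

theorem r1_err : (fun x => (F x).r1 - P.r1 (w x)) =O[l] u := by
  refine isBigO_pi.2 fun j => ?_
  have hG : ∀ k, (fun x => (F x).G k j * (w x).y k) =O[l] fun _ => (1 : ℝ) := fun k => by
    simpa only [mul_one] using (isBigO_apply (h.tendsto_FG.isBigO_one ℝ) k j).mul
      ((h.tendsto_y k).isBigO_one ℝ)
  have hH : ∀ k, (fun x => (F x).H k j * (w x).z k) =O[l] fun _ => (1 : ℝ) := fun k => by
    simpa only [mul_one] using (isBigO_apply (h.tendsto_FH.isBigO_one ℝ) k j).mul (h.z_isBigO k)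
  have hf : (fun x => (F x).gradf j) =O[l] fun _ => (1 : ℝ) :=
    (tendsto_ofLp_apply (h.tendsto_of_err h.gradf_err h.tendsto_gradf) j).isBigO_one ℝ
  have h1 : (fun x => (F x).r1 j - ((F x).gradf j + ∑ k, (F x).G k j * (w x).y k
      + ∑ k, (F x).H k j * (w x).z k)) =O[l] u := by
    have h2 := (isBigO_refl u l).mul ((hf.norm_left.add
      (IsBigO.fun_sum (s := Finset.univ) fun k _ => (hG k).norm_left)).add
      (IsBigO.fun_sum (s := Finset.univ) fun k _ => (hH k).norm_left))
    simp only [mul_one] at h2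
    refine (IsBigO.of_norm_eventuallyLE ?_).trans (h2.const_mul_left c)
    filter_upwards [h.valid] with x hx
    obtain ⟨θ₀, θG, θH, h₀, hθG, hθH, hr⟩ := hx.r1_round j
    have e1 : (F x).r1 j - ((F x).gradf j + ∑ k, (F x).G k j * (w x).y k
        + ∑ k, (F x).H k j * (w x).z k) = (F x).gradf j * θ₀
          + ∑ k, (F x).G k j * (w x).y k * θG k + ∑ k, (F x).H k j * (w x).z k * θH k := by
      rw [hr]
      simp only [mul_add, Finset.sum_add_distrib, mul_one]
      ring
    have key : ∀ A θ : ℝ, |θ| ≤ c * u x → |A * θ| ≤ c * (u x * ‖A‖) := fun A θ hθ => by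
      rw [abs_mul, Real.norm_eq_abs]
      have := mul_le_mul_of_nonneg_left hθ (abs_nonneg A)
      linarith
    rw [e1, Real.norm_eq_abs, mul_add, mul_add, mul_add, mul_add, Finset.mul_sum, Finset.mul_sum,
      Finset.mul_sum, Finset.mul_sum]
    refine (abs_add_le _ _).trans (add_le_add ((abs_add_le _ _).trans (add_le_add ?_ ?_)) ?_)
    · exact key _ _ h₀
    · exact (Finset.abs_sum_le_sum_abs _ _).trans
        (Finset.sum_le_sum fun k _ => key _ _ (hθG k))
    · exact (Finset.abs_sum_le_sum_abs _ _).trans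
        (Finset.sum_le_sum fun k _ => key _ _ (hθH k))
  have h2 : (fun x => (F x).gradf j - gradient P.f (w x).x j) =O[l] u :=
    isBigO_pi.1 (isBigO_ofLp h.gradf_err) j
  have h3 := isBigO_pi.1 (isBigO_mulVec (isBigO_transpose h.G_err)
    (isBigO_pi.2 fun i => (h.tendsto_y i).isBigO_one ℝ)) j
  have h4 := isBigO_pi.1 (isBigO_mulVec (isBigO_transpose h.H_err) (isBigO_pi.2 h.z_isBigO)) j
  simp only [mul_one] at h3 h4
  refine (((h1.add h2).add h3).add h4).congr_left fun x => ?_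
  simp only [NLP.r1, Pi.sub_apply, Pi.add_apply, Matrix.mulVec, dotProduct,
    Matrix.transpose_apply, Matrix.sub_apply, sub_mul, Finset.sum_sub_distrib]
  ring

theorem rbar2_isBigO : (fun x => P.rbar2 (w x)) =O[l] ξ := (isBigO_ofLp h.g_isBigO).neg_left

theorem computed_rbar2_isBigO : (fun x => (F x).rbar2) =O[l] ξ :=
  (isBigO_ofLp h.Fg_isBigO).neg_left

theorem deltaRbar2_isBigO : (fun x => (F x).deltaRbar2 P (w x)) =O[l] u := by
  refine (isBigO_ofLp h.g_err).neg_left.congr_left fun x => ?_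
  funext i
  simp only [FloatEval.deltaRbar2, FloatEval.rbar2, NLP.rbar2, NLP.r3, Pi.neg_apply, Pi.sub_apply,
    PiLp.sub_apply]
  ring

theorem sGamma_isBigO :
    (fun x => P.sGamma (γ x) (μ x) (w x)) =O[l] fun _ => (1 : ℝ) := by
  have h1 := isBigO_mulVec (isBigO_transpose (h.tendsto_H.isBigO_one ℝ)) h.inner_isBigO
  have h2 := h.γ_isBigO.smul
    (isBigO_mulVec (isBigO_transpose (h.tendsto_G.isBigO_one ℝ)) h.rbar2_isBigO)
  simp only [mul_one, one_mul, smul_eq_mul] at h1 h2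
  have h3 : (fun x => γ x • ((P.G (w x))ᵀ *ᵥ P.rbar2 (w x))) =O[l] fun _ => (1 : ℝ) := by
    refine h2.congr' EventuallyEq.rfl ?_
    filter_upwards [h.ξ_pos] with x hx
    exact inv_mul_cancel₀ hx.ne'
  exact (h.r1_isBigO.add h1).neg_left.add h3

/-- The error in `s_γ` is an element of order `u / ξ` of the row space of the active Jacobian plus a
vector of order `u`. -/
theorem exists_deltaS_decomposition [Fintype (P.activeSet ws.x)] :
    ∃ (Y : X → Fin me ⊕ P.activeSet ws.x → ℝ) (e : X → Fin n → ℝ),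
      (∀ x, (F x).deltaS P (γ x) (μ x) (w x) =
        (activeRows (P.activeSet ws.x) (P.G (w x)) (P.H (w x)))ᵀ *ᵥ Y x + e x) ∧
      Y =O[l] (fun x => u x * (ξ x)⁻¹) ∧ e =O[l] u := by
  let t : X → Fin mi → ℝ := fun x => ((w x).Ds * P.r4 (w x) - P.r2 (μ x) (w x))
    - ((F x).Ds * (F x).r4 - (F x).r2)
  let y : X → Fin me → ℝ := fun x => γ x • (F x).deltaRbar2 P (w x)
  have ht : t =O[l] fun x => u x * (ξ x)⁻¹ :=
    h.inner_err.neg_left.congr_left fun x => neg_sub _ _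
  have hy : y =O[l] fun x => u x * (ξ x)⁻¹ :=
    (h.γ_isBigO.smul h.deltaRbar2_isBigO).congr_right fun x => mul_comm _ _
  have hti : (fun x => (P.activeSet ws.x)ᶜ.indicator (t x)) =O[l] u :=
    indicator_isBigO fun i hi => (h.inner_err_inactive hi).neg_left.congr_left fun x => by
      simp only [t, Pi.sub_apply]; ring
  refine ⟨fun x => activeWeights _ (y x) (t x), fun x =>
    (P.H (w x))ᵀ *ᵥ ((P.activeSet ws.x)ᶜ.indicator (t x))
      - ((F x).r1 - P.r1 (w x))
      - ((F x).H - P.H (w x))ᵀ *ᵥ ((F x).Ds * (F x).r4 - (F x).r2)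
      + γ x • (((F x).G - P.G (w x))ᵀ *ᵥ (F x).rbar2), fun x => ?_, ?_, ?_⟩
  · have h1 := transpose_mulVec_add_eq (P.activeSet ws.x) (P.G (w x)) (P.H (w x)) (y x) (t x)
    have h2 : (F x).deltaS P (γ x) (μ x) (w x) = (P.G (w x))ᵀ *ᵥ y x + (P.H (w x))ᵀ *ᵥ t x
        - ((F x).r1 - P.r1 (w x))
        - ((F x).H - P.H (w x))ᵀ *ᵥ ((F x).Ds * (F x).r4 - (F x).r2)
        + γ x • (((F x).G - P.G (w x))ᵀ *ᵥ (F x).rbar2) := by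
      simp only [FloatEval.deltaS, FloatEval.sGamma, FloatEval.rbar1, NLP.sGamma, NLP.rbar1, y, t,
        FloatEval.deltaRbar2, Matrix.transpose_sub, Matrix.sub_mulVec, Matrix.mulVec_smul,
        Matrix.mulVec_sub, smul_sub]
      abel
    rw [h2, h1]
    beta_reduce
    abel
  · refine isBigO_pi.2 fun i => ?_
    rcases i with i | i
    · exact isBigO_pi.1 hy i
    · exact isBigO_pi.1 ht i.val
  · have h1 := isBigO_mulVec (isBigO_transpose (h.tendsto_H.isBigO_one ℝ)) hti
    have h2 := isBigO_mulVec (isBigO_transpose h.H_err) h.computed_inner_isBigO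
    have h3 := h.γ_isBigO.smul (isBigO_mulVec (isBigO_transpose h.G_err) h.computed_rbar2_isBigO)
    simp only [one_mul, mul_one, smul_eq_mul] at h1 h2 h3
    have h4 : (fun x => (ξ x)⁻¹ * (u x * ξ x)) =ᶠ[l] u := by
      filter_upwards [h.ξ_pos] with x hx
      field_simp
    exact ((h1.sub h.r1_err).sub h2).add (h3.congr' EventuallyEq.rfl h4)

end IsRegime

namespace IsRegime

variable {X : Type*} {n me mi : ℕ} {P : NLP n me mi} {ws : Point n me mi}
  {C α a b M c ε : ℝ} {l : Filter X} {w : X → Point n me mi} {ξ γ μ u : X → ℝ}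
  {F : X → FloatEval n me mi} (h : IsRegime P ws C α a b M c ε l w ξ γ μ u F)
include h

section Bounds

variable [Fintype (P.activeSet ws.x)] [DecidableEq (P.activeSet ws.x)]

theorem eventually_isUnit_det : ∀ᶠ x in l, IsUnit (P.KGamma (γ x) (w x)).det := by
  simpa only [← KGamma_eq_penaltyMatrix] using h.penaltyFamily.eventually_isUnit_det

theorem eventually_isUnit_det_computed : ∀ᶠ x in l, IsUnit (F x).KGamma.det := by
  simpa only [← computed_eq_penaltyMatrix] using h.penaltyFamily_computed.eventually_isUnit_det

theorem isBigO_KGamma_inv :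
    (fun x => (P.KGamma (γ x) (w x))⁻¹) =O[l] fun _ => (1 : ℝ) := by
  simpa only [← KGamma_eq_penaltyMatrix] using h.penaltyFamily.isBigO_inv

theorem isBigO_computed_inv : (fun x => (F x).KGamma⁻¹) =O[l] fun _ => (1 : ℝ) := by
  simpa only [← computed_eq_penaltyMatrix] using h.penaltyFamily_computed.isBigO_inv

theorem isBigO_KGamma_inv_mul_transpose :
    (fun x => (P.KGamma (γ x) (w x))⁻¹
      * (activeRows (P.activeSet ws.x) (P.G (w x)) (P.H (w x)))ᵀ) =O[l] ξ := by
  simpa only [← KGamma_eq_penaltyMatrix] using h.penaltyFamily.isBigO_inv_mul_transpose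

theorem isBigO_computed_inv_mul_transpose :
    (fun x => (F x).KGamma⁻¹
      * (activeRows (P.activeSet ws.x) (F x).G (F x).H)ᵀ) =O[l] ξ := by
  simpa only [← computed_eq_penaltyMatrix] using
    h.penaltyFamily_computed.isBigO_inv_mul_transpose

theorem isBigO_computed_G_mul_inv : (fun x => (F x).G * (F x).KGamma⁻¹) =O[l] ξ := by
  have h1 : (fun x => activeRows (P.activeSet ws.x) (F x).G (F x).H * (F x).KGamma⁻¹) =O[l] ξ := by
    simpa only [← computed_eq_penaltyMatrix] using h.penaltyFamily_computed.isBigO_J_mul_inv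
  exact isBigO_matrix fun i j => isBigO_apply h1 (Sum.inl i) j

theorem isBigO_KGamma_inv_deltaS :
    (fun x => (P.KGamma (γ x) (w x))⁻¹ *ᵥ (F x).deltaS P (γ x) (μ x) (w x)) =O[l] u := by
  obtain ⟨Y, e, hYe, hY, he⟩ := h.exists_deltaS_decomposition
  have h1 := isBigO_mulVec h.isBigO_KGamma_inv_mul_transpose hY
  have h2 := isBigO_mulVec h.isBigO_KGamma_inv he
  simp only [one_mul] at h2
  refine ((h1.congr' EventuallyEq.rfl ?_).add h2).congr_left fun x => ?_
  · refine EventuallyEq.trans (Eventually.of_forall fun x => ?_) (h.mul_inv_eq u)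
    ring
  · rw [hYe, Matrix.mulVec_add, Matrix.mulVec_mulVec]

theorem isBigO_computed_inv_deltaS :
    (fun x => (F x).KGamma⁻¹ *ᵥ (F x).deltaS P (γ x) (μ x) (w x)) =O[l] u := by
  obtain ⟨Y, e, hYe, hY, he⟩ := h.exists_deltaS_decomposition
  have h1 := isBigO_mulVec h.isBigO_computed_inv_mul_transpose hY
  have h2 := isBigO_mulVec h.isBigO_computed_inv he
  have h3 := isBigO_mulVec h.isBigO_computed_inv (isBigO_mulVec (isBigO_transpose
    (activeRows_isBigO (P := P) (ws := ws) h.G_err h.H_err))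
    (hY.trans h.u_mul_inv_isBigO_one))
  simp only [one_mul, mul_one] at h2 h3
  refine (((h1.congr' EventuallyEq.rfl ?_).add h2).sub h3).congr_left fun x => ?_
  · refine EventuallyEq.trans (Eventually.of_forall fun x => ?_) (h.mul_inv_eq u)
    ring
  · have hsub : activeRows (P.activeSet ws.x) ((F x).G - P.G (w x)) ((F x).H - P.H (w x))
        = activeRows (P.activeSet ws.x) (F x).G (F x).H
          - activeRows (P.activeSet ws.x) (P.G (w x)) (P.H (w x)) := by
      ext i j
      rcases i with i | i <;> rfl
    rw [hYe, hsub, Matrix.mulVec_add, Matrix.transpose_sub, Matrix.sub_mulVec, Matrix.mulVec_sub,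
      Matrix.mulVec_mulVec, Matrix.mulVec_mulVec]
    abel

theorem isBigO_propagated_error :
    (fun x => -(F x).deltaRbar2 P (w x)
      + (F x).G *ᵥ ((F x).KGamma⁻¹ *ᵥ (F x).deltaS P (γ x) (μ x) (w x))) =O[l] u := by
  have h1 := isBigO_mulVec (h.tendsto_FG.isBigO_one ℝ) h.isBigO_computed_inv_deltaS
  simp only [one_mul] at h1
  exact h.deltaRbar2_isBigO.neg_left.add h1

theorem isBigO_operator_error :
    (fun x => (F x).G * (F x).KGamma⁻¹ - P.G (w x) * (P.KGamma (γ x) (w x))⁻¹) =O[l] u := by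
  have h1 := isBigO_matrix_mul h.G_err h.isBigO_KGamma_inv
  have h2 := isBigO_matrix_mul (isBigO_matrix_mul h.isBigO_computed_G_mul_inv h.KGamma_err)
    h.isBigO_KGamma_inv
  simp only [mul_one] at h1 h2
  have h3 : (fun x => ξ x * (u x * (ξ x)⁻¹)) =ᶠ[l] u :=
    EventuallyEq.trans (Eventually.of_forall fun x => by ring) (h.mul_inv_eq u)
  refine (h1.sub (h2.congr' EventuallyEq.rfl h3)).congr' ?_ EventuallyEq.rfl
  filter_upwards [h.eventually_isUnit_det, h.eventually_isUnit_det_computed] with x hx hx'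
  rw [Matrix.mul_sub, Matrix.sub_mul, Matrix.sub_mul, Matrix.mul_assoc _ _ (F x).KGamma,
    Matrix.nonsing_inv_mul _ hx', Matrix.mul_one,
    Matrix.mul_assoc _ (P.KGamma (γ x) (w x)) _, Matrix.mul_nonsing_inv _ hx, Matrix.mul_one]
  abel

omit h [Fintype (P.activeSet ws.x)] [DecidableEq (P.activeSet ws.x)] in
theorem rGamma_sub_eq (F : FloatEval n me mi) (γ μ : ℝ) (w : Point n me mi) :
    F.rGamma γ - (F.G *ᵥ (F.KGamma⁻¹ *ᵥ P.sGamma γ μ w) - P.rbar2 w)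
      = -F.deltaRbar2 P w + F.G *ᵥ (F.KGamma⁻¹ *ᵥ F.deltaS P γ μ w) := by
  simp only [FloatEval.rGamma, FloatEval.deltaRbar2, FloatEval.deltaS, Matrix.mulVec_sub]
  abel

theorem isBigO_rGamma_error :
    (fun x => (F x).rGamma (γ x) - P.rGamma (γ x) (μ x) (w x)) =O[l] u := by
  have h1 := isBigO_mulVec h.isBigO_operator_error h.sGamma_isBigO
  simp only [mul_one] at h1
  refine (h.isBigO_propagated_error.add h1).congr_left fun x => ?_
  rw [← rGamma_sub_eq, Matrix.sub_mulVec, NLP.rGamma, Matrix.mulVec_mulVec, Matrix.mulVec_mulVec]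
  abel

theorem deltaS_isBigO :
    (fun x => (F x).deltaS P (γ x) (μ x) (w x)) =O[l] fun x => u x * (ξ x)⁻¹ := by
  obtain ⟨Y, e, hYe, hY, he⟩ := h.exists_deltaS_decomposition
  have h1 := isBigO_mulVec (isBigO_transpose
    ((tendsto_activeRows (P := P) (ws := ws) h.tendsto_G h.tendsto_H).isBigO_one ℝ)) hY
  simp only [one_mul] at h1
  exact (h1.add (he.trans (h.isBigO_mul_ξ_inv u))).congr_left fun x => (hYe x).symm

end Bounds

section Spectral

variable {U : X → Matrix (Fin n) (Fin n) ℝ} {σ : X → Fin n → ℝ}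
  (hs : IsSpectralFamily l (fun x => P.KGamma (γ x) (w x)) U σ)
include hs

omit h hs in
theorem card_activeRows [Fintype (P.activeSet ws.x)] :
    Fintype.card (Fin me ⊕ P.activeSet ws.x) = P.largeDim ws.x := by
  rw [Fintype.card_sum, Fintype.card_fin, NLP.largeDim, Set.ncard_eq_toFinset_card',
    Set.toFinset_card]

variable [Fintype (P.activeSet ws.x)] [DecidableEq (P.activeSet ws.x)]

theorem isBigO_large_inv (i : LargeIdx n (P.largeDim ws.x)) :
    (fun x => (σ x i.val)⁻¹) =O[l] ξ := by
  simp only [KGamma_eq_penaltyMatrix (ws := ws)] at hs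
  exact hs.isBigO_large_inv h.penaltyFamily i.val (by rw [card_activeRows]; exact i.2)

theorem isBigO_eigenvalue_inv (i : Fin n) : (fun x => (σ x i)⁻¹) =O[l] fun _ => (1 : ℝ) := by
  simp only [KGamma_eq_penaltyMatrix (ws := ws)] at hs
  exact hs.isBigO_eigenvalue_inv h.penaltyFamily i

theorem isBigO_colsL_deltaS (p : ℕ) :
    (fun x => (colsL p (U x))ᵀ *ᵥ (F x).deltaS P (γ x) (μ x) (w x))
      =O[l] fun x => u x * (ξ x)⁻¹ := by
  have hU : (fun x => colsL p (U x)) =O[l] fun _ => (1 : ℝ) :=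
    isBigO_matrix fun i j => isBigO_apply hs.isBigO_U i j.val
  simpa only [one_mul] using isBigO_mulVec (isBigO_transpose hU) h.deltaS_isBigO

theorem isBigO_colsS_deltaS :
    (fun x => (colsS (P.largeDim ws.x) (U x))ᵀ *ᵥ (F x).deltaS P (γ x) (μ x) (w x)) =O[l] u := by
  obtain ⟨Y, e, hYe, hY, he⟩ := h.exists_deltaS_decomposition
  have hU : (fun x => colsS (P.largeDim ws.x) (U x)) =O[l] fun _ => (1 : ℝ) :=
    isBigO_matrix fun i j => isBigO_apply hs.isBigO_U i j.val
  simp only [KGamma_eq_penaltyMatrix (ws := ws)] at hs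
  have h1 := isBigO_mulVec (isBigO_transpose
    (hs.isBigO_J_mul_colsS h.penaltyFamily _ card_activeRows)) hY
  have h2 := isBigO_mulVec (isBigO_transpose hU) he
  simp only [one_mul] at h2
  refine ((h1.congr' EventuallyEq.rfl ?_).add h2).congr_left fun x => ?_
  · exact EventuallyEq.trans (Eventually.of_forall fun x => by ring) (h.mul_inv_eq u)
  · rw [hYe, Matrix.mulVec_add, Matrix.mulVec_mulVec, Matrix.transpose_mul]

theorem isBigO_diagL_inv :
    (fun x => Matrix.diagonal fun i : LargeIdx n (P.largeDim ws.x) => (σ x i.val)⁻¹) =O[l] ξ :=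
  isBigO_diagonal (isBigO_pi.2 fun i => h.isBigO_large_inv hs i)

theorem isBigO_diagS_inv :
    (fun x => Matrix.diagonal fun i : SmallIdx n (P.largeDim ws.x) => (σ x i.val)⁻¹)
      =O[l] fun _ => (1 : ℝ) :=
  isBigO_diagonal (isBigO_pi.2 fun i => h.isBigO_eigenvalue_inv hs i.val)

end Spectral

end IsRegime

theorem exists_eventually_norm_le {X : Type*} {l : Filter X} {E : Type*} [NormedAddCommGroup E]
    {A : X → E} {f : X → ℝ} (hA : A =O[l] f) (hf : ∀ᶠ x in l, 0 ≤ f x) :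
    ∃ B₀ : ℝ, ∀ B ≥ B₀, ∀ᶠ x in l, ‖A x‖ ≤ B * f x := by
  obtain ⟨B₀, hB⟩ := hA.bound
  refine ⟨B₀, fun B hBB => ?_⟩
  filter_upwards [hB, hf] with x hx hfx
  rw [Real.norm_of_nonneg hfx] at hx
  exact hx.trans (mul_le_mul_of_nonneg_right hBB hfx)

theorem exists_eventually_norm2_le {X : Type*} {l : Filter X} {p : Type} [Fintype p]
    {A : X → p → ℝ} {f : X → ℝ} (hA : A =O[l] f) (hf : ∀ᶠ x in l, 0 ≤ f x) :
    ∃ B₀ : ℝ, ∀ B ≥ B₀, ∀ᶠ x in l, norm2 (A x) ≤ B * f x := by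
  simpa only [Real.norm_of_nonneg (norm2_nonneg _)] using
    exists_eventually_norm_le (isBigO_norm2 hA) hf

namespace IsRegime

variable {X : Type*} {n me mi : ℕ} {P : NLP n me mi} {ws : Point n me mi}
  {C α a b M c ε : ℝ} {l : Filter X} {w : X → Point n me mi} {ξ γ μ u : X → ℝ}
  {F : X → FloatEval n me mi} (h : IsRegime P ws C α a b M c ε l w ξ γ μ u F)
include h

theorem exists_error_bounds : ∃ B₀ : ℝ, ∀ B ≥ B₀, ∀ᶠ x in l,
    IsUnit (P.KGamma (γ x) (w x)).det ∧ IsUnit (F x).KGamma.det ∧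
    norm2 ((F x).rGamma (γ x) - P.rGamma (γ x) (μ x) (w x)) ≤ B * u x ∧
    norm2 (-(F x).deltaRbar2 P (w x)
      + (F x).G *ᵥ ((F x).KGamma⁻¹ *ᵥ (F x).deltaS P (γ x) (μ x) (w x))) ≤ B * u x ∧
    norm2 ((P.KGamma (γ x) (w x))⁻¹ *ᵥ (F x).deltaS P (γ x) (μ x) (w x)) ≤ B * u x := by
  classical
  have := Fintype.ofFinite (P.activeSet ws.x)
  have hu : ∀ᶠ x in l, 0 ≤ u x := h.u_pos.mono fun _ hx => hx.le
  obtain ⟨B₁, h₁⟩ := exists_eventually_norm2_le h.isBigO_rGamma_error hu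
  obtain ⟨B₂, h₂⟩ := exists_eventually_norm2_le h.isBigO_propagated_error hu
  obtain ⟨B₃, h₃⟩ := exists_eventually_norm2_le h.isBigO_KGamma_inv_deltaS hu
  refine ⟨max B₁ (max B₂ B₃), fun B hB => ?_⟩
  rw [ge_iff_le, max_le_iff, max_le_iff] at hB
  filter_upwards [h.eventually_isUnit_det, h.eventually_isUnit_det_computed, h₁ B hB.1,
    h₂ B hB.2.1, h₃ B hB.2.2] with x e₁ e₂ e₃ e₄ e₅
  exact ⟨e₁, e₂, e₃, e₄, e₅⟩

theorem exists_spectral_bounds {U : X → Matrix (Fin n) (Fin n) ℝ} {σ : X → Fin n → ℝ}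
    (hs : IsSpectralFamily l (fun x => P.KGamma (γ x) (w x)) U σ) :
    ∃ B₀ : ℝ, ∀ B ≥ B₀, ∀ᶠ x in l,
      IsUnit (diagL (P.largeDim ws.x) (σ x)).det ∧ IsUnit (diagS (P.largeDim ws.x) (σ x)).det ∧
      ‖(diagL (P.largeDim ws.x) (σ x))⁻¹‖ ≤ B * ξ x ∧
      ‖(diagS (P.largeDim ws.x) (σ x))⁻¹‖ ≤ B ∧
      norm2 ((colsL (P.largeDim ws.x) (U x))ᵀ *ᵥ (F x).deltaS P (γ x) (μ x) (w x))
        ≤ B * (u x / ξ x) ∧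
      norm2 ((colsS (P.largeDim ws.x) (U x))ᵀ *ᵥ (F x).deltaS P (γ x) (μ x) (w x)) ≤ B * u x ∧
      norm2 ((diagL (P.largeDim ws.x) (σ x))⁻¹ *ᵥ
        ((colsL (P.largeDim ws.x) (U x))ᵀ *ᵥ (F x).deltaS P (γ x) (μ x) (w x))) ≤ B * u x ∧
      (P.KGamma (γ x) (w x))⁻¹ *ᵥ (F x).deltaS P (γ x) (μ x) (w x)
        = colsL (P.largeDim ws.x) (U x) *ᵥ ((diagL (P.largeDim ws.x) (σ x))⁻¹ *ᵥ
            ((colsL (P.largeDim ws.x) (U x))ᵀ *ᵥ (F x).deltaS P (γ x) (μ x) (w x)))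
          + colsS (P.largeDim ws.x) (U x) *ᵥ ((diagS (P.largeDim ws.x) (σ x))⁻¹ *ᵥ
            ((colsS (P.largeDim ws.x) (U x))ᵀ *ᵥ (F x).deltaS P (γ x) (μ x) (w x))) := by
  classical
  have := Fintype.ofFinite (P.activeSet ws.x)
  have hu : ∀ᶠ x in l, 0 ≤ u x := h.u_pos.mono fun _ hx => hx.le
  have hξ : ∀ᶠ x in l, 0 ≤ ξ x := h.ξ_pos.mono fun _ hx => hx.le
  have huξ : ∀ᶠ x in l, 0 ≤ u x * (ξ x)⁻¹ := by
    filter_upwards [hu, hξ] with x h1 h2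
    exact mul_nonneg h1 (inv_nonneg.2 h2)
  have hLd := (isBigO_mulVec (h.isBigO_diagL_inv hs)
    (h.isBigO_colsL_deltaS hs (P.largeDim ws.x))).congr' EventuallyEq.rfl
    (EventuallyEq.trans (Eventually.of_forall fun x => by ring) (h.mul_inv_eq u))
  obtain ⟨B₁, h₁⟩ := exists_eventually_norm_le (h.isBigO_diagL_inv hs) hξ
  obtain ⟨B₂, h₂⟩ := exists_eventually_norm_le (h.isBigO_diagS_inv hs)
    (Eventually.of_forall fun _ => zero_le_one)
  obtain ⟨B₃, h₃⟩ := exists_eventually_norm2_le (h.isBigO_colsL_deltaS hs (P.largeDim ws.x)) huξ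
  obtain ⟨B₄, h₄⟩ := exists_eventually_norm2_le (h.isBigO_colsS_deltaS hs) hu
  obtain ⟨B₅, h₅⟩ := exists_eventually_norm2_le hLd hu
  refine ⟨max B₁ (max B₂ (max B₃ (max B₄ B₅))), fun B hB => ?_⟩
  rw [ge_iff_le, max_le_iff, max_le_iff, max_le_iff, max_le_iff] at hB
  filter_upwards [h.eventually_isUnit_det, hs.mem_orthogonal, hs.eq, h₁ B hB.1, h₂ B hB.2.1,
    h₃ B hB.2.2.1, h₄ B hB.2.2.2.1, h₅ B hB.2.2.2.2] with x hdet hU hA e₁ e₂ e₃ e₄ e₅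
  obtain ⟨hσ, hinv⟩ := inv_of_diagonalization hU hA hdet
  have hL := diag_block_inv (p := LargeIdx n (P.largeDim ws.x)) fun i => hσ i.val
  have hS := diag_block_inv (p := SmallIdx n (P.largeDim ws.x)) fun i => hσ i.val
  have hL' : (diagL (P.largeDim ws.x) (σ x))⁻¹ = diagL (P.largeDim ws.x) fun i => (σ x i)⁻¹ := hL.2
  have hS' : (diagS (P.largeDim ws.x) (σ x))⁻¹ = diagS (P.largeDim ws.x) fun i => (σ x i)⁻¹ := hS.2
  rw [hL', hS', hinv]
  rw [mul_one] at e₂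
  rw [← div_eq_mul_inv] at e₃
  exact ⟨hL.1, hS.1, e₁, e₂, e₃, e₄, e₅, diagonal_split _ _ _ _⟩

end IsRegime

section Approach

variable {n me mi : ℕ}

/-- An iterate with its parameters and a floating-point evaluation. -/
structure Sample (n me mi : ℕ) where
  w : Point n me mi
  γ : ℝ
  μ : ℝ
  u : ℝ
  F : FloatEval n me mi

/-- The iterate is central, the parameters are in their ranges and the evaluation is valid. -/
structure Sample.IsAdmissible (P : NLP n me mi) (C α a b M c ε : ℝ) (q : Sample n me mi) :
    Prop where
  central : P.IsCentral C α q.w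
  le_γ : a / q.w.dualityMeasure ≤ q.γ
  γ_le : q.γ ≤ b / q.w.dualityMeasure
  μ_pos : 0 < q.μ
  μ_le : q.μ ≤ M * q.w.dualityMeasure
  u_pos : 0 < q.u
  valid : q.F.IsValid P q.w q.γ q.μ q.u c ε

/-- The filter of samples in `S` whose iterate tends to `ws` and for which `u / ξ` tends to zero. -/
noncomputable def approach {X : Type*} (ws : Point n me mi) (q : X → Sample n me mi) (S : Set X) : Filter X :=
  comap (fun x => ((q x).w.distance ws, (q x).u / (q x).w.dualityMeasure)) (𝓝 (0, 0)) ⊓ 𝓟 S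

theorem Sample.IsAdmissible.dualityMeasure_pos {P : NLP n me mi} {C α a b M c ε : ℝ}
    {q : Sample n me mi} (hM : 0 < M) (hq : q.IsAdmissible P C α a b M c ε) :
    0 < q.w.dualityMeasure :=
  pos_of_mul_pos_right (hq.μ_pos.trans_le hq.μ_le) hM.le

variable {X : Type*} {P : NLP n me mi} {ws : Point n me mi} {C α a b M c ε : ℝ}
  {q : X → Sample n me mi} {S : Set X}

theorem isRegime_approach (hP : P.IsC2) (hreg : P.IsRegularSolution ws) (hα : 0 < α) (ha : 0 < a)
    (hM : 0 < M) (hS : ∀ x ∈ S, (q x).IsAdmissible P C α a b M c ε) :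
    IsRegime P ws C α a b M c ε (approach ws q S) (fun x => (q x).w)
      (fun x => (q x).w.dualityMeasure) (fun x => (q x).γ) (fun x => (q x).μ) (fun x => (q x).u)
      (fun x => (q x).F) := by
  have hS' : ∀ᶠ x in approach ws q S, (q x).IsAdmissible P C α a b M c ε :=
    Eventually.filter_mono inf_le_right (eventually_principal.2 hS)
  have ht : Tendsto (fun x => ((q x).w.distance ws, (q x).u / (q x).w.dualityMeasure))
      (approach ws q S) (𝓝 (0, 0)) := tendsto_comap.mono_left inf_le_left
  exact {
    c2 := hP
    regular := hreg
    α_pos := hα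
    a_pos := ha
    ξ_eq := fun _ => rfl
    tendsto_distance := (continuous_fst.tendsto _).comp ht
    tendsto_u_div := (continuous_snd.tendsto _).comp ht
    central := hS'.mono fun _ hx => hx.central
    le_γ := hS'.mono fun _ hx => hx.le_γ
    γ_le := hS'.mono fun _ hx => hx.γ_le
    ξ_pos := hS'.mono fun _ hx => hx.dualityMeasure_pos hM
    μ_nonneg := hS'.mono fun _ hx => hx.μ_pos.le
    μ_le := hS'.mono fun _ hx => hx.μ_le
    u_pos := hS'.mono fun _ hx => hx.u_pos
    valid := hS'.mono fun _ hx => hx.valid }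

theorem exists_radius_of_eventually_approach (hM : 0 < M)
    (hS : ∀ x ∈ S, (q x).IsAdmissible P C α a b M c ε) {p : X → Prop}
    (hp : ∀ᶠ x in approach ws q S, p x) :
    ∃ r > 0, ∀ x ∈ S, (q x).w.distance ws ≤ r → (q x).u ≤ r * (q x).w.dualityMeasure → p x := by
  rw [approach, eventually_inf_principal, eventually_comap,
    Metric.nhds_basis_closedBall.eventually_iff] at hp
  obtain ⟨r, hr, hball⟩ := hp
  refine ⟨r, hr, fun x hx hd hu => hball ?_ x rfl hx⟩
  have hξ := (hS x hx).dualityMeasure_pos hM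
  rw [Metric.mem_closedBall, Prod.dist_eq, max_le_iff, dist_zero_right, dist_zero_right,
    Real.norm_of_nonneg (distance_nonneg _ _),
    Real.norm_of_nonneg (div_pos (hS x hx).u_pos hξ).le, div_le_iff₀ hξ]
  exact ⟨hd, hu⟩

end Approach

end HyKKT

theorem mainTheorem4 {n me mi : ℕ} (P : HyKKT.NLP n me mi) (hP : P.IsC2)
    (wstar : HyKKT.Point n me mi) (hreg : P.IsRegularSolution wstar)
    (C α a b M c ε : ℝ) (hC : 0 < C) (hα : 0 < α) (hα1 : α < 1) (ha : 0 < a) (hab : a ≤ b)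
    (hM : 0 < M) (hc : 0 ≤ c) (hε : 0 ≤ ε) :
    ∃ ρ > 0, ∃ η > 0, ∃ B > 0, ∀ w : HyKKT.Point n me mi,
      w.distance wstar ≤ ρ → P.IsCentral C α w →
      ∀ γ μ u : ℝ, a / w.dualityMeasure ≤ γ → γ ≤ b / w.dualityMeasure →
      0 < μ → μ ≤ M * w.dualityMeasure →
      0 < u → u ≤ η * w.dualityMeasure →
      ∀ F : HyKKT.FloatEval n me mi, F.IsValid P w γ μ u c ε →
      IsUnit (P.KGamma γ w).det ∧ IsUnit F.KGamma.det ∧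
      -- error with respect to exact arithmetic
      HyKKT.norm2 (F.rGamma γ - P.rGamma γ μ w) ≤ B * u ∧
      -- error propagated from the data `s_γ`, `r̄₂` through the computed operator
      F.rGamma γ - (F.G *ᵥ (F.KGamma⁻¹ *ᵥ P.sGamma γ μ w) - P.rbar2 w)
        = -F.deltaRbar2 P w + F.G *ᵥ (F.KGamma⁻¹ *ᵥ F.deltaS P γ μ w) ∧
      HyKKT.norm2 (-F.deltaRbar2 P w + F.G *ᵥ (F.KGamma⁻¹ *ᵥ F.deltaS P γ μ w)) ≤ B * u ∧
      HyKKT.norm2 ((P.KGamma γ w)⁻¹ *ᵥ F.deltaS P γ μ w) ≤ B * u ∧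
      -- damping in the large space: `K_γ = U Σ Uᵀ`, eigenvalues in decreasing magnitude
      ∀ (l : ℕ) (U : Matrix (Fin n) (Fin n) ℝ) (σ : Fin n → ℝ),
        l = P.largeDim wstar.x →
        U ∈ Matrix.orthogonalGroup (Fin n) ℝ →
        P.KGamma γ w = U * Matrix.diagonal σ * Uᵀ →
        Antitone (fun i => |σ i|) →
        IsUnit (HyKKT.diagL l σ).det ∧ IsUnit (HyKKT.diagS l σ).det ∧
        ‖(HyKKT.diagL l σ)⁻¹‖ ≤ B * w.dualityMeasure ∧
        ‖(HyKKT.diagS l σ)⁻¹‖ ≤ B ∧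
        HyKKT.norm2 ((HyKKT.colsL l U)ᵀ *ᵥ F.deltaS P γ μ w) ≤ B * (u / w.dualityMeasure) ∧
        HyKKT.norm2 ((HyKKT.colsS l U)ᵀ *ᵥ F.deltaS P γ μ w) ≤ B * u ∧
        HyKKT.norm2 ((HyKKT.diagL l σ)⁻¹ *ᵥ ((HyKKT.colsL l U)ᵀ *ᵥ F.deltaS P γ μ w)) ≤ B * u ∧
        (P.KGamma γ w)⁻¹ *ᵥ F.deltaS P γ μ w
          = HyKKT.colsL l U *ᵥ
              ((HyKKT.diagL l σ)⁻¹ *ᵥ ((HyKKT.colsL l U)ᵀ *ᵥ F.deltaS P γ μ w))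
            + HyKKT.colsS l U *ᵥ
              ((HyKKT.diagS l σ)⁻¹ *ᵥ ((HyKKT.colsS l U)ᵀ *ᵥ F.deltaS P γ μ w)) := by
  let S₁ : Set (HyKKT.Sample n me mi) := {q | q.IsAdmissible P C α a b M c ε}
  let S₂ : Set (HyKKT.Sample n me mi × Matrix (Fin n) (Fin n) ℝ × (Fin n → ℝ)) :=
    {x | x.1.IsAdmissible P C α a b M c ε ∧ x.2.1 ∈ Matrix.orthogonalGroup (Fin n) ℝ ∧
      P.KGamma x.1.γ x.1.w = x.2.1 * Matrix.diagonal x.2.2 * x.2.1ᵀ ∧ Antitone fun i => |x.2.2 i|}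
  have hS₁ : ∀ q ∈ S₁, (id q).IsAdmissible P C α a b M c ε := fun q hq => hq
  have hS₂ : ∀ x ∈ S₂, x.1.IsAdmissible P C α a b M c ε := fun x hx => hx.1
  have hev : ∀ᶠ x in HyKKT.approach wstar Prod.fst S₂, x ∈ S₂ :=
    Filter.Eventually.filter_mono inf_le_right (Filter.eventually_principal.2 fun x hx => hx)
  obtain ⟨B₁, hB₁⟩ :=
    (HyKKT.isRegime_approach hP hreg hα ha hM hS₁).exists_error_bounds
  obtain ⟨B₂, hB₂⟩ :=
    (HyKKT.isRegime_approach hP hreg hα ha hM hS₂).exists_spectral_bounds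
      (U := fun x => x.2.1) (σ := fun x => x.2.2)
      ⟨hev.mono fun _ hx => hx.2.1, hev.mono fun _ hx => hx.2.2.1, hev.mono fun _ hx => hx.2.2.2⟩
  obtain ⟨r₁, hr₁, h₁⟩ := HyKKT.exists_radius_of_eventually_approach hM hS₁
    (hB₁ (max 1 (max B₁ B₂)) ((le_max_left _ _).trans (le_max_right _ _)))
  obtain ⟨r₂, hr₂, h₂⟩ := HyKKT.exists_radius_of_eventually_approach hM hS₂
    (hB₂ (max 1 (max B₁ B₂)) ((le_max_right _ _).trans (le_max_right _ _)))
  refine ⟨min r₁ r₂, lt_min hr₁ hr₂, min r₁ r₂, lt_min hr₁ hr₂, max 1 (max B₁ B₂),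
    lt_max_of_lt_left one_pos, ?_⟩
  intro w hw hcent γ μ u hγ hγ' hμ hμ' hu hu' F hF
  have hadm : HyKKT.Sample.IsAdmissible P C α a b M c ε ⟨w, γ, μ, u, F⟩ :=
    ⟨hcent, hγ, hγ', hμ, hμ', hu, hF⟩
  have hξ : 0 ≤ w.dualityMeasure := (hadm.dualityMeasure_pos hM).le
  obtain ⟨e₁, e₂, e₃, e₄, e₅⟩ := h₁ ⟨w, γ, μ, u, F⟩ hadm (hw.trans (min_le_left _ _))
    (hu'.trans (mul_le_mul_of_nonneg_right (min_le_left _ _) hξ))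
  refine ⟨e₁, e₂, e₃, HyKKT.IsRegime.rGamma_sub_eq F γ μ w, e₄, e₅, ?_⟩
  rintro l U σ rfl hU hK hσ
  exact h₂ ⟨⟨w, γ, μ, u, F⟩, U, σ⟩ ⟨hadm, hU, hK, hσ⟩ (hw.trans (min_le_right _ _))
    (hu'.trans (mul_le_mul_of_nonneg_right (min_le_right _ _) hξ))
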